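/- Let $\Sigma$ be a finite first-order signature, where each symbol has a fixed arity in $\mathbb{N}$, and let $\mathcal{X}$ be a countably infinite set of variables. Let $\mathrm{Ter}^\infty(\Sigma)$ be the set of finite and infinite terms over $\Sigma$ and $\mathcal{X}$: partial maps $t$ from positions in $\mathbb{N}^*$ to $\Sigma\cup\mathcal{X}$ such that $t(\epsilon)$ is defined, and $t(pi)$ is defined if and only if $t(p)\in\Sigma$ has some arity $n$ with $1\le i\le n$. The distance $d(s,t)$ is $0$ if $s=t$, and otherwise $2^{-k}$ where $k$ is the least length of a position $p$ with $s(p)\neq t(p)$. An infinitary term rewriting system (iTRS) $\mathcal{R}$ is a finite set of rules $\ell\to r$ where $\ell$ is a finite term that is not a variable, $r\in\mathrm{Ter}^\infty(\Sigma)$, and every variable of $r$ occurs in $\ell$. A rule is collapsing if $r$ is a variable. A rewrite step $s\to t$ at position $p$ means that there are a rule $\ell\to r$ of $\mathcal{R}$ and a substitution $\sigma$ with $s|_p=\ell^\sigma$ and $t=s[r^\sigma]_p$; its depth is the length of $p$. We write $s\twoheadrightarrow^{\infty}t$ if there is a strongly convergent rewrite sequence from $s$ to $t$, that is, for some ordinal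 $\alpha$, a sequence of steps $(t_\beta\to t_{\beta+1})_{\beta<\alpha}$ with $t_0=s$ such that, for every limit ordinal $\lambda<\alpha$, as $\beta$ approaches $\lambda$ from below, $d(t_\beta,t_\lambda)$ tends to $0$ and the depth of the steps tends to infinity; and such that, if $\alpha$ is a limit ordinal, the depth of the steps tends to infinity and $d(t_\beta,t)$ tends to $0$ also as $\beta$ approaches $\alpha$, while $t=t_\alpha$ if $\alpha$ is not a limit ordinal. $\mathcal{R}$ is weakly orthogonal if no variable occurs twice in a left-hand side and all critical pairs are trivial. Here, for rules $\ell_1\to r_1$ and $\ell_2\to r_2$ (possibly equal) and a position $p$ of $\ell_1$ with $\ell_1(p)\in\Sigma$ such that $\ell_1|_p$ and $\ell_2$ have a most general common instance $(\ell_1|_p)^\sigma=\ell_2^\tau$, where $\sigma$ is the identity on variables outside $\ell_1|_p$ and the variables of $(\ell_1|_p)^\sigma$ do not occur in $\ell_1[\Box]_p$, the pair $\langle \ell_1^\sigma[r_2^\tau]_p,\ r_1^\sigma\rangle$ is a critical pair; it is trivial if its two components are equal. **Theorem.** Let $\mathcal{R}$ be a weakly orthogonal iTRS without collapsing rules. Then: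 1. $\mathcal{R}$ is infinitarily confluent: if $t\twoheadrightarrow^{\infty}t_1$ and $t\twoheadrightarrow^{\infty}t_2$, then there is a term $s$ with $t_1\twoheadrightarrow^{\infty}s$ and $t_2\twoheadrightarrow^{\infty}s$. 2. $\mathcal{R}$ has the infinitary Church–Rosser property $\mathrm{CR}^\infty$: if $t_1$ and $t_2$ are related by the reflexive transitive closure of $\twoheadrightarrow^{\infty}\cup\twoheadleftarrow^{\infty}$, where $\twoheadleftarrow^{\infty}$ is the converse of $\twoheadrightarrow^{\infty}$, then there is a term $s$ with $t_1\twoheadrightarrow^{\infty}s$ and $t_2\twoheadrightarrow^{\infty}s$. 3. $\mathcal{R}$ has unique infinitary normal forms ($\mathrm{UN}^\infty$): if $t_1$ and $t_2$ are related by the same closure and neither of them admits a rewrite step, then $t_1=t_2$. -/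

import Mathlib

open Filter Topology

namespace InfRew

universe u v w

/-- A first-order signature: a finite set of symbols, each having a fixed arity. -/
structure Signature where
  Symb : Type u
  arity : Symb → ℕ
  finite_symb : Finite Symb

/-- A partial map from positions (finite sequences of natural numbers) to symbols and variables is
a term if its root is defined, and a position `p i` is defined iff `p` carries a function symbol
of some arity `n` with `1 ≤ i ≤ n`. -/
def IsTerm (S : Signature.{u}) {X : Type v} (t : List ℕ → Option (S.Symb ⊕ X)) : Prop :=
  (t []).isSome ∧
    ∀ (p : List ℕ) (i : ℕ), (t (p ++ [i])).isSome ↔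
      ∃ f : S.Symb, t p = some (Sum.inl f) ∧ 1 ≤ i ∧ i ≤ S.arity f

/-- Finite or infinite terms over the signature `S` and the set of variables `X`. -/
@[ext]
structure ITerm (S : Signature.{u}) (X : Type v) where
  toFun : List ℕ → Option (S.Symb ⊕ X)
  isTerm : IsTerm S toFun

theorem IsTerm.shift {S : Signature.{u}} {X : Type v} {t : List ℕ → Option (S.Symb ⊕ X)}
    (ht : IsTerm S t) {p : List ℕ} (hp : (t p).isSome) : IsTerm S (fun q => t (p ++ q)) := by
  refine ⟨by simpa using hp, fun q i => ?_⟩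
  have h := ht.2 (p ++ q) i
  simpa [List.append_assoc] using h

/-- The positions of a term are closed under prefixes. -/
theorem IsTerm.isSome_of_append {S : Signature.{u}} {X : Type v}
    {t : List ℕ → Option (S.Symb ⊕ X)} (ht : IsTerm S t) (p q : List ℕ)
    (h : (t (p ++ q)).isSome) : (t p).isSome := by
  induction q using List.reverseRecOn with
  | nil => simpa using h
  | append_singleton q i ih =>
    rw [← List.append_assoc] at h
    obtain ⟨f, hf, -⟩ := (ht.2 (p ++ q) i).1 h
    exact ih (by simp [hf])

/-- The value at a position of the result of replacing each variable `x` in `t` by `σ x`. -/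
def substFun {S : Signature.{u}} {X : Type v} {Y : Type w} (σ : X → ITerm S Y) :
    (List ℕ → Option (S.Symb ⊕ X)) → List ℕ → Option (S.Symb ⊕ Y)
  | t, [] =>
    match t [] with
    | none => none
    | some (Sum.inl f) => some (Sum.inl f)
    | some (Sum.inr x) => (σ x).toFun []
  | t, i :: p =>
    match t [] with
    | none => none
    | some (Sum.inl _) => substFun σ (fun q => t (i :: q)) p
    | some (Sum.inr x) => (σ x).toFun (i :: p)

theorem substFun_none {S : Signature.{u}} {X : Type v} {Y : Type w} (σ : X → ITerm S Y)
    (t : List ℕ → Option (S.Symb ⊕ X)) (h : t [] = none) (p : List ℕ) :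
    substFun σ t p = none := by
  cases p <;> simp [substFun, h]

theorem substFun_var {S : Signature.{u}} {X : Type v} {Y : Type w} (σ : X → ITerm S Y)
    (t : List ℕ → Option (S.Symb ⊕ X)) (x : X) (h : t [] = some (Sum.inr x)) (p : List ℕ) :
    substFun σ t p = (σ x).toFun p := by
  cases p <;> simp [substFun, h]

theorem substFun_isSome {S : Signature.{u}} {X : Type v} {Y : Type w} (σ : X → ITerm S Y)
    (t : List ℕ → Option (S.Symb ⊕ X)) :
    (substFun σ t []).isSome ↔ (t []).isSome := by
  rcases h : t [] with _ | (f | x)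
  · simp [substFun, h]
  · simp [substFun, h]
  · simpa [substFun, h] using (σ x).isTerm.1

theorem isTerm_substFun {S : Signature.{u}} {X : Type v} {Y : Type w} (σ : X → ITerm S Y)
    {t : List ℕ → Option (S.Symb ⊕ X)} (ht : IsTerm S t) : IsTerm S (substFun σ t) := by
  refine ⟨(substFun_isSome σ t).2 ht.1, fun p => ?_⟩
  induction p generalizing t with
  | nil =>
    intro i
    rcases h : t [] with _ | (f | x)
    · simpa [h] using ht.1
    · have h1 := ht.2 [] i
      simp only [List.nil_append] at h1 ⊢
      have h2 : substFun σ t [i] = substFun σ (fun q => t (i :: q)) [] := by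
        simp [substFun, h]
      rw [h2, substFun_isSome, h1]
      simp [substFun, h]
    · simpa [substFun_var σ t x h] using (σ x).isTerm.2 [] i
  | cons j p ih =>
    intro i
    rcases h : t [] with _ | (f | x)
    · simpa [h] using ht.1
    · have h2 : ∀ q, substFun σ t (j :: q) = substFun σ (fun q => t (j :: q)) q := by
        intro q
        simp [substFun, h]
      simp only [List.cons_append, h2]
      by_cases hj : (t [j]).isSome
      · exact ih (ht.shift hj) i
      · have h3 : ∀ q, substFun σ (fun q => t (j :: q)) q = none :=
          substFun_none σ (fun q => t (j :: q)) (by simpa using hj)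
        simp [h3]
    · simpa [substFun_var σ t x h] using (σ x).isTerm.2 (j :: p) i

namespace ITerm

variable {S : Signature.{u}} {X : Type v} {Y : Type w}

/-- The set of positions of a term. -/
def Pos (t : ITerm S X) : Set (List ℕ) := {p | (t.toFun p).isSome}

/-- A term is finite if its set of positions is finite. -/
def IsFinite (t : ITerm S X) : Prop := t.Pos.Finite

/-- The set of variables occurring in a term. -/
def vars (t : ITerm S X) : Set X := {x | ∃ p, t.toFun p = some (Sum.inr x)}

/-- The set of variables occurring in `t` outside the subterm at position `p`, that is, the
variables of the context `t[□]_p`. -/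
def varsOutside (t : ITerm S X) (p : List ℕ) : Set X :=
  {x | ∃ q, ¬ p <+: q ∧ t.toFun q = some (Sum.inr x)}

/-- The term consisting of a variable. -/
def var (x : X) : ITerm S X where
  toFun p := match p with
    | [] => some (Sum.inr x)
    | _ :: _ => none
  isTerm := by
    refine ⟨rfl, fun p i => ?_⟩
    cases p <;> simp

/-- A term is a variable if its root symbol is one. -/
def IsVar (t : ITerm S X) : Prop := ∃ x, t.toFun [] = some (Sum.inr x)

/-- The application of a substitution `σ` to a term. -/
def subst (σ : X → ITerm S Y) (t : ITerm S X) : ITerm S Y where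
  toFun := substFun σ t.toFun
  isTerm := isTerm_substFun σ t.isTerm

open Classical in
/-- The subterm of `t` at the position `p` of `t`
(and, as a convention that is never used, `t` itself if `p` is not a position of `t`). -/
noncomputable def subterm (t : ITerm S X) (p : List ℕ) : ITerm S X :=
  if hp : p ∈ t.Pos then ⟨fun q => t.toFun (p ++ q), t.isTerm.shift hp⟩ else t

theorem isTerm_replace (s : ITerm S X) (p : List ℕ) (hp : p ∈ s.Pos) (t : ITerm S X) :
    IsTerm S (fun q => if p <+: q then t.toFun (q.drop p.length) else s.toFun q) := by
  constructor
  · by_cases h : p <+: []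
    · simpa [h] using t.isTerm.1
    · simpa [h] using s.isTerm.1
  · intro q i
    by_cases h : p <+: q
    · have h' : p <+: q ++ [i] := h.trans (List.prefix_append q [i])
      obtain ⟨r, rfl⟩ := h
      simpa [List.append_assoc] using t.isTerm.2 r i
    · by_cases h' : p <+: q ++ [i]
      · have hpq : p = q ++ [i] := by
          rcases List.prefix_concat_iff.1 h' with h1 | h1
          · exact h1
          · exact absurd h1 h
        subst hpq
        have h1 : (s.toFun (q ++ [i])).isSome := hp
        simp only [List.prefix_refl, if_true, List.drop_length, h, if_false]
        exact ⟨fun _ => (s.isTerm.2 q i).1 h1, fun _ => t.isTerm.1⟩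
      · simpa [h, h'] using s.isTerm.2 q i

open Classical in
/-- The term `s[t]_p` obtained from `s` by replacing the subterm at the position `p` of `s` by `t`
(and, as a convention that is never used, `s` itself if `p` is not a position of `s`). -/
noncomputable def replaceAt (s : ITerm S X) (p : List ℕ) (t : ITerm S X) : ITerm S X :=
  if hp : p ∈ s.Pos then
    ⟨fun q => if p <+: q then t.toFun (q.drop p.length) else s.toFun q, isTerm_replace s p hp t⟩
  else s

open Classical in
/-- The metric on terms: `0` for equal terms, and otherwise `2⁻ᵏ` where `k` is the least length of
a position at which the terms differ. -/
noncomputable def metric (s t : ITerm S X) : ℝ :=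
  if s = t then 0
  else (2 : ℝ)⁻¹ ^ sInf {k : ℕ | ∃ p : List ℕ, p.length = k ∧ s.toFun p ≠ t.toFun p}

end ITerm

/-- An infinitary rewrite rule: the left-hand side is a finite term and not a variable, the
right-hand side is a finite or infinite term, whose variables all occur in the left-hand side. -/
structure IRule (S : Signature.{u}) (X : Type v) where
  lhs : ITerm S X
  rhs : ITerm S X
  lhs_finite : lhs.IsFinite
  lhs_not_var : ¬ lhs.IsVar
  vars_subset : rhs.vars ⊆ lhs.vars

/-- A rule is collapsing if its right-hand side is a variable. -/
def IRule.IsCollapsing {S : Signature.{u}} {X : Type v} (ρ : IRule S X) : Prop := ρ.rhs.IsVar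

/-- `σ` and `τ` give a common instance of `a` and `b` which is most general: every common instance
of `a` and `b` is an instance of it. -/
def IsMostGeneralCommonInstance {S : Signature.{u}} {X : Type v} (a b : ITerm S X)
    (σ τ : X → ITerm S X) : Prop :=
  a.subst σ = b.subst τ ∧
    ∀ σ' τ' : X → ITerm S X, a.subst σ' = b.subst τ' →
      ∃ δ : X → ITerm S X, a.subst σ' = (a.subst σ).subst δ

/-- `(t, s)` is a critical pair of the rule `ρ₁` with the inner rule `ρ₂`. -/
def IsCriticalPair {S : Signature.{u}} {X : Type v} (ρ₁ ρ₂ : IRule S X) (t s : ITerm S X) : Prop :=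
  ∃ (p : List ℕ) (f : S.Symb) (σ τ : X → ITerm S X),
    ρ₁.lhs.toFun p = some (Sum.inl f) ∧
    IsMostGeneralCommonInstance (ρ₁.lhs.subterm p) ρ₂.lhs σ τ ∧
    (∀ x, x ∉ (ρ₁.lhs.subterm p).vars → σ x = ITerm.var x) ∧
    Disjoint ((ρ₁.lhs.subterm p).subst σ).vars (ρ₁.lhs.varsOutside p) ∧
    t = (ρ₁.lhs.subst σ).replaceAt p (ρ₂.rhs.subst τ) ∧
    s = ρ₁.rhs.subst σ

/-- An infinitary term rewriting system over the signature `S` and the variables `X`, with finitely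
many rules. -/
structure ITRS (S : Signature.{u}) (X : Type v) where
  rules : Set (IRule S X)
  finite_rules : rules.Finite

namespace ITRS

variable {S : Signature.{u}} {X : Type v}

/-- No left-hand side contains two occurrences of the same variable. -/
def LeftLinear (R : ITRS S X) : Prop :=
  ∀ ρ ∈ R.rules, ∀ (x : X) (p q : List ℕ),
    ρ.lhs.toFun p = some (Sum.inr x) → ρ.lhs.toFun q = some (Sum.inr x) → p = q

/-- Left-linear, and all critical pairs are trivial. -/
def WeaklyOrthogonal (R : ITRS S X) : Prop :=
  R.LeftLinear ∧
    ∀ ρ₁ ∈ R.rules, ∀ ρ₂ ∈ R.rules, ∀ t s : ITerm S X, IsCriticalPair ρ₁ ρ₂ t s → t = s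

/-- The system contains no collapsing rules. -/
def NonCollapsing (R : ITRS S X) : Prop := ∀ ρ ∈ R.rules, ¬ ρ.IsCollapsing

/-- `s` rewrites to `t` by contracting a redex at position `p`. -/
def StepAt (R : ITRS S X) (p : List ℕ) (s t : ITerm S X) : Prop :=
  ∃ ρ ∈ R.rules, ∃ σ : X → ITerm S X,
    p ∈ s.Pos ∧ s.subterm p = ρ.lhs.subst σ ∧ t = s.replaceAt p (ρ.rhs.subst σ)

/-- The one-step rewrite relation. -/
def Step (R : ITRS S X) (s t : ITerm S X) : Prop := ∃ p, R.StepAt p s t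

/-- `t` and `p` form a strongly continuous transfinite rewrite sequence of length `α`: the step
from `t β` to `t (β + 1)` takes place at position `p β` for all `β < α`, and at every limit ordinal
`l < α` the terms converge and the depth of the steps tends to infinity. Values of `t` beyond `α`
and of `p` from `α` on are irrelevant. -/
structure IsRewriteSeq (R : ITRS S X) (α : Ordinal.{0}) (t : Ordinal.{0} → ITerm S X)
    (p : Ordinal.{0} → List ℕ) : Prop where
  step : ∀ β < α, R.StepAt (p β) (t β) (t (β + 1))
  dist_tendsto : ∀ l < α, Order.IsSuccLimit l →
    Tendsto (fun β => (t β).metric (t l)) (𝓝[<] l) (𝓝 0)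
  depth_tendsto : ∀ l < α, Order.IsSuccLimit l →
    Tendsto (fun β => (p β).length) (𝓝[<] l) atTop

/-- A rewrite sequence of length `α` is strongly convergent if `α` is not a limit ordinal, or the
depth of the steps tends to infinity also at `α`. -/
def IsStronglyConvergent (α : Ordinal.{0}) (p : Ordinal.{0} → List ℕ) : Prop :=
  Order.IsSuccLimit α → Tendsto (fun β => (p β).length) (𝓝[<] α) atTop

/-- `u` is the final term of a rewrite sequence of length `α`: the last term if `α` is not a limit
ordinal, and the limit of the terms if it is. -/
def IsFinalTerm (α : Ordinal.{0}) (t : Ordinal.{0} → ITerm S X) (u : ITerm S X) : Prop :=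
  (¬ Order.IsSuccLimit α → u = t α) ∧
    (Order.IsSuccLimit α → Tendsto (fun β => (t β).metric u) (𝓝[<] α) (𝓝 0))

/-- The infinitary rewrite relation: there is a strongly convergent transfinite rewrite sequence
from `s` with final term `u`. Strongly convergent sequences have countable length, hence it is no
restriction that the length ranges over the ordinals of the lowest universe. -/
def InfRed (R : ITRS S X) (s u : ITerm S X) : Prop :=
  ∃ (α : Ordinal.{0}) (t : Ordinal.{0} → ITerm S X) (p : Ordinal.{0} → List ℕ),
    R.IsRewriteSeq α t p ∧ IsStronglyConvergent α p ∧ t 0 = s ∧ IsFinalTerm α t u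

/-- The conversion relation: the reflexive transitive closure of the union of the infinitary
rewrite relation and its converse. -/
def InfConv (R : ITRS S X) : ITerm S X → ITerm S X → Prop :=
  Relation.ReflTransGen (fun a b => R.InfRed b a ∨ R.InfRed a b)

/-- A normal form is a term that admits no rewrite step. -/
def IsNormalForm (R : ITRS S X) (t : ITerm S X) : Prop := ¬ ∃ t', R.Step t t'

/-- Infinitary confluence. -/
def InfConfluent (R : ITRS S X) : Prop :=
  ∀ t t₁ t₂ : ITerm S X, R.InfRed t t₁ → R.InfRed t t₂ → ∃ s, R.InfRed t₁ s ∧ R.InfRed t₂ s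

/-- The infinitary Church-Rosser property. -/
def InfChurchRosser (R : ITRS S X) : Prop :=
  ∀ t₁ t₂ : ITerm S X, R.InfConv t₁ t₂ → ∃ s, R.InfRed t₁ s ∧ R.InfRed t₂ s

/-- Infinitary unique normalization. -/
def InfUniqueNormalization (R : ITRS S X) : Prop :=
  ∀ t₁ t₂ : ITerm S X, R.InfConv t₁ t₂ → R.IsNormalForm t₁ → R.IsNormalForm t₂ → t₁ = t₂

end ITRS

end InfRew

/-!
Transfinite rewrite sequences are replaced by the coinductive relation `ITRS.Red`: `s` reduces to
`t` if finitely many steps lead from `s` to a term with the root symbol of `t`, and the immediate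
subterms reduce coinductively to those of `t`. For left-linear systems this is the relation
`InfRed` (`ITRS.infRed_iff_red`). In one direction this is compression: a redex pattern is finite,
so a step after an infinitary reduction can be done after finitely many steps already
(`ITRS.Red.tail_stepAt`), whence `Red` is transitive, and limits are handled by chains of
reductions at increasing depth (`ITRS.RedChain`). In the other direction a coinductive reduction
unfolds to a sequence of length at most `ω`.

Confluence of `Red` rests on a parallel moves lemma. A parallel step `ITRS.Par` contracts a possibly
infinite set of redexes at disjoint positions. If a step overlaps with one of these redexes, then
triviality of the critical pairs says that both contractions have the same result
(`ITRS.WeaklyOrthogonal.overlap`), so the step may be replaced by a contraction that belongs to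
the parallel step; otherwise the usual residuals exist. Hence overlaps simply cancel, and parallel
steps commute with single steps (`ITRS.Par.exists_of_stepAt`) and with infinitary reductions
(`ITRS.Red.exists_of_par`).

The absence of collapsing rules enters through the depth: residuals of steps below the root stay
below the root, as no right-hand side is a variable (`ITRS.RootStep.exists_of_lift_red`). So two
coinitial reductions can be continued to reductions whose source and targets share the root symbol
and that are both without root steps, and a common reduct is generated corecursively
(`ITRS.Red.confluent`). The Church–Rosser property and uniqueness of normal forms follow by
transitivity.
-/

namespace InfRew

universe u v w

/-! ### Terms as nodes over their immediate subterms -/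

namespace ITerm

variable {S : Signature.{u}} {X : Type v} {Y : Type w}

theorem ext_toFun {s t : ITerm S X} (h : ∀ p, s.toFun p = t.toFun p) : s = t :=
  ITerm.ext (funext h)

/-- The term with root symbol `f` and immediate subterms `ts`. The subterm `ts i` sits at the
position `[i + 1]`, as positions count arguments from `1`. -/
def node (f : S.Symb) (ts : Fin (S.arity f) → ITerm S X) : ITerm S X where
  toFun p := match p with
    | [] => some (Sum.inl f)
    | i :: p => if h : 1 ≤ i ∧ i ≤ S.arity f then (ts ⟨i - 1, by omega⟩).toFun p else none
  isTerm := by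
    refine ⟨rfl, fun p i => ?_⟩
    rcases p with _ | ⟨j, p⟩
    · simp only [List.nil_append]
      by_cases h : 1 ≤ i ∧ i ≤ S.arity f
      · simp only [h, and_self, dif_pos]
        simpa [h] using (ts ⟨i - 1, by omega⟩).isTerm.1
      · simp [h]
    · simp only [List.cons_append]
      by_cases h : 1 ≤ j ∧ j ≤ S.arity f
      · simpa only [h, and_self, dif_pos] using (ts ⟨j - 1, by omega⟩).isTerm.2 p i
      · simp [h]

@[simp] theorem node_nil (f : S.Symb) (ts : Fin (S.arity f) → ITerm S X) :
    (node f ts).toFun [] = some (Sum.inl f) := rfl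

@[simp] theorem node_cons (f : S.Symb) (ts : Fin (S.arity f) → ITerm S X) (i : Fin (S.arity f))
    (p : List ℕ) : (node f ts).toFun ((i.val + 1) :: p) = (ts i).toFun p := by
  have : 1 ≤ i.val + 1 ∧ i.val + 1 ≤ S.arity f := by omega
  simp [node]

theorem node_cons_none (f : S.Symb) (ts : Fin (S.arity f) → ITerm S X) (j : ℕ) (p : List ℕ)
    (h : ∀ i : Fin (S.arity f), j ≠ i.val + 1) : (node f ts).toFun (j :: p) = none := by
  have : ¬ (1 ≤ j ∧ j ≤ S.arity f) := fun hj => h ⟨j - 1, by omega⟩ (by simp; omega)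
  simp only [node]
  rw [dif_neg this]

theorem node_cons_isSome {f : S.Symb} {ts : Fin (S.arity f) → ITerm S X} {j : ℕ} {p : List ℕ}
    (h : ((node f ts).toFun (j :: p)).isSome) :
    ∃ i : Fin (S.arity f), j = i.val + 1 ∧ ((ts i).toFun p).isSome := by
  by_contra! hc
  by_cases hj : ∃ i : Fin (S.arity f), j = i.val + 1
  · obtain ⟨i, rfl⟩ := hj
    simp at h
    exact absurd h (by simpa using hc i rfl)
  · push Not at hj
    simp [node_cons_none f ts j p hj] at h

@[simp] theorem var_nil (x : X) : (var x : ITerm S X).toFun [] = some (Sum.inr x) := rfl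

@[simp] theorem var_cons (x : X) (i : ℕ) (p : List ℕ) :
    (var x : ITerm S X).toFun (i :: p) = none := rfl

theorem eq_var_of_root {t : ITerm S X} {x : X} (h : t.toFun [] = some (Sum.inr x)) :
    t = var x := by
  refine ext_toFun fun p => ?_
  have key : ∀ i q, t.toFun (i :: q) = none := by
    intro i q
    by_contra hc
    have h1 : (t.toFun [i]).isSome :=
      t.isTerm.isSome_of_append [i] q (by simpa [Option.isSome_iff_ne_none] using hc)
    obtain ⟨f, hf, -⟩ := (t.isTerm.2 [] i).1 h1
    simp [h] at hf
  rcases p with _ | ⟨i, p⟩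
  · simpa using h
  · simp [key]

theorem eq_node_of_root {t : ITerm S X} {f : S.Symb} (h : t.toFun [] = some (Sum.inl f)) :
    ∃ ts, t = node f ts := by
  have hs : ∀ i : Fin (S.arity f), (t.toFun [i.val + 1]).isSome := fun i =>
    (t.isTerm.2 [] (i.val + 1)).2 ⟨f, h, by omega, by omega⟩
  refine ⟨fun i => ⟨fun q => t.toFun ([i.val + 1] ++ q), t.isTerm.shift (hs i)⟩, ?_⟩
  refine ext_toFun fun p => ?_
  rcases p with _ | ⟨j, p⟩
  · simpa using h
  · by_cases hj : ∃ i : Fin (S.arity f), j = i.val + 1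
    · obtain ⟨i, rfl⟩ := hj
      simp
    · push Not at hj
      rw [node_cons_none f _ j p hj]
      by_contra hc
      have h1 : (t.toFun [j]).isSome :=
        t.isTerm.isSome_of_append [j] p (by simpa [Option.isSome_iff_ne_none] using hc)
      obtain ⟨g, hg, h2, h3⟩ := (t.isTerm.2 [] j).1 h1
      rw [h] at hg
      cases hg
      exact hj ⟨j - 1, by omega⟩ (by simp; omega)

theorem var_or_node (t : ITerm S X) : (∃ x, t = var x) ∨ ∃ f ts, t = node f ts := by
  rcases h : t.toFun [] with _ | (f | x)
  · have := t.isTerm.1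
    simp [h] at this
  · exact Or.inr ⟨f, eq_node_of_root h⟩
  · exact Or.inl ⟨x, eq_var_of_root h⟩

theorem node_inj {f : S.Symb} {ss ts : Fin (S.arity f) → ITerm S X}
    (h : node f ss = node f ts) : ss = ts := by
  funext i
  refine ext_toFun fun p => ?_
  have := congrArg (fun t => t.toFun ((i.val + 1) :: p)) h
  simpa using this

theorem node_root_inj {f g : S.Symb} {ss : Fin (S.arity f) → ITerm S X}
    {ts : Fin (S.arity g) → ITerm S X} (h : node f ss = node g ts) : f = g := by
  have := congrArg (fun t => t.toFun []) h
  simpa using this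

theorem var_ne_node {x : X} {f : S.Symb} {ts : Fin (S.arity f) → ITerm S X} :
    (var x : ITerm S X) ≠ node f ts := by
  intro h
  have := congrArg (fun t => t.toFun []) h
  simp at this

/-! ### Substitution, subterms and replacement on nodes -/

@[simp] theorem subst_var (σ : X → ITerm S Y) (x : X) : (var x : ITerm S X).subst σ = σ x :=
  ext_toFun fun p => substFun_var σ _ x rfl p

@[simp] theorem subst_node (σ : X → ITerm S Y) (f : S.Symb) (ts : Fin (S.arity f) → ITerm S X) :
    (node f ts).subst σ = node f (fun i => (ts i).subst σ) := by
  refine ext_toFun fun p => ?_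
  rcases p with _ | ⟨j, p⟩
  · rfl
  · change substFun σ (fun q => (node f ts).toFun (j :: q)) p = _
    by_cases hj : ∃ i : Fin (S.arity f), j = i.val + 1
    · obtain ⟨i, rfl⟩ := hj
      simp only [node_cons]
      rfl
    · push Not at hj
      rw [node_cons_none _ _ _ _ hj]
      exact substFun_none σ _ (node_cons_none _ _ _ _ hj) p

/-- The value of an instance at a position of a function symbol of the pattern. -/
theorem subst_toFun_symb (σ : X → ITerm S Y) {a : ITerm S X} {p : List ℕ} {f : S.Symb}
    (h : a.toFun p = some (Sum.inl f)) : (a.subst σ).toFun p = some (Sum.inl f) := by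
  induction p generalizing a with
  | nil =>
    obtain ⟨ts, rfl⟩ := eq_node_of_root h
    simp
  | cons j p ih =>
    rcases a.var_or_node with ⟨x, rfl⟩ | ⟨g, ts, rfl⟩
    · simp at h
    · obtain ⟨i, rfl, -⟩ := node_cons_isSome (Option.isSome_iff_exists.2 ⟨_, h⟩)
      simp only [node_cons, subst_node] at h ⊢
      exact ih h

/-- The values of an instance below a variable position of the pattern. -/
theorem subst_toFun_var (σ : X → ITerm S Y) {a : ITerm S X} {p : List ℕ} {x : X}
    (h : a.toFun p = some (Sum.inr x)) (q : List ℕ) :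
    (a.subst σ).toFun (p ++ q) = (σ x).toFun q := by
  induction p generalizing a with
  | nil =>
    rw [eq_var_of_root h]
    simp
  | cons j p ih =>
    rcases a.var_or_node with ⟨y, rfl⟩ | ⟨g, ts, rfl⟩
    · simp at h
    · obtain ⟨i, rfl, -⟩ := node_cons_isSome (Option.isSome_iff_exists.2 ⟨_, h⟩)
      simp only [node_cons, subst_node, List.cons_append] at h ⊢
      exact ih h

/-- A position of an instance either carries a function symbol of the pattern or lies below one
of its variables. -/
theorem mem_pos_subst {σ : X → ITerm S Y} {a : ITerm S X} {p : List ℕ}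
    (h : p ∈ (a.subst σ).Pos) :
    (∃ f, a.toFun p = some (Sum.inl f)) ∨
      ∃ v q x, p = v ++ q ∧ a.toFun v = some (Sum.inr x) ∧ q ∈ (σ x).Pos := by
  induction p generalizing a with
  | nil =>
    rcases a.var_or_node with ⟨x, rfl⟩ | ⟨g, ts, rfl⟩
    · exact Or.inr ⟨[], [], x, rfl, rfl, by simpa using h⟩
    · exact Or.inl ⟨g, rfl⟩
  | cons j p ih =>
    rcases a.var_or_node with ⟨x, rfl⟩ | ⟨g, ts, rfl⟩
    · exact Or.inr ⟨[], j :: p, x, rfl, rfl, by simpa using h⟩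
    · rw [subst_node] at h
      obtain ⟨i, rfl, hi⟩ := node_cons_isSome h
      rcases ih hi with ⟨f, hf⟩ | ⟨v, q, x, rfl, hv, hq⟩
      · exact Or.inl ⟨f, by simpa using hf⟩
      · exact Or.inr ⟨(i.val + 1) :: v, q, x, rfl, by simpa using hv, hq⟩

theorem nil_mem_pos (t : ITerm S X) : [] ∈ t.Pos := t.isTerm.1

@[simp] theorem cons_mem_pos_node {f : S.Symb} {ts : Fin (S.arity f) → ITerm S X}
    {i : Fin (S.arity f)} {p : List ℕ} : (i.val + 1) :: p ∈ (node f ts).Pos ↔ p ∈ (ts i).Pos := by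
  simp [Pos]

theorem subterm_toFun {t : ITerm S X} {p : List ℕ} (hp : p ∈ t.Pos) (q : List ℕ) :
    (t.subterm p).toFun q = t.toFun (p ++ q) := by
  simp [subterm, hp]

@[simp] theorem subterm_nil (t : ITerm S X) : t.subterm [] = t :=
  ext_toFun fun q => by rw [subterm_toFun t.nil_mem_pos]; rfl

theorem subterm_node {f : S.Symb} {ts : Fin (S.arity f) → ITerm S X}
    {i : Fin (S.arity f)} {p : List ℕ} (hp : p ∈ (ts i).Pos) :
    (node f ts).subterm ((i.val + 1) :: p) = (ts i).subterm p := by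
  refine ext_toFun fun q => ?_
  rw [subterm_toFun (cons_mem_pos_node.2 hp), subterm_toFun hp]
  simp

@[simp] theorem replaceAt_nil (s t : ITerm S X) : s.replaceAt [] t = t := by
  refine ext_toFun fun q => ?_
  simp [replaceAt, s.nil_mem_pos]

theorem replaceAt_toFun {s : ITerm S X} {p : List ℕ} (hp : p ∈ s.Pos) (t : ITerm S X)
    (q : List ℕ) [Decidable (p <+: q)] :
    (s.replaceAt p t).toFun q = if p <+: q then t.toFun (q.drop p.length) else s.toFun q := by
  simp only [replaceAt, hp, dif_pos]
  congr

theorem replaceAt_node {f : S.Symb} {ts : Fin (S.arity f) → ITerm S X}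
    {i : Fin (S.arity f)} {p : List ℕ} (hp : p ∈ (ts i).Pos) (t : ITerm S X) :
    (node f ts).replaceAt ((i.val + 1) :: p) t =
      node f (Function.update ts i ((ts i).replaceAt p t)) := by
  classical
  refine ext_toFun fun q => ?_
  rw [replaceAt_toFun (cons_mem_pos_node.2 hp)]
  rcases q with _ | ⟨j, q⟩
  · simp
  · by_cases hj : ∃ k : Fin (S.arity f), j = k.val + 1
    · obtain ⟨k, rfl⟩ := hj
      simp only [node_cons, List.cons_prefix_cons, List.length_cons, List.drop_succ_cons]
      by_cases hk : k = i
      · subst hk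
        simp [replaceAt_toFun hp]
      · have : ¬ i.val = k.val := fun h => hk (Fin.ext h.symm)
        simp [hk, this]
    · push Not at hj
      have : ¬ (i.val + 1 = j) := fun h => hj i h.symm
      simp [node_cons_none f _ j q hj, this]

/-- A substitution acts on a term through the variables of that term only. -/
theorem subst_congr {a : ITerm S X} {σ τ : X → ITerm S Y} (h : ∀ x ∈ a.vars, σ x = τ x) :
    a.subst σ = a.subst τ := by
  refine ext_toFun fun p => ?_
  induction p generalizing a with
  | nil =>
    rcases a.var_or_node with ⟨x, rfl⟩ | ⟨g, ts, rfl⟩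
    · rw [subst_var, subst_var, h x ⟨[], rfl⟩]
    · simp
  | cons j p ih =>
    rcases a.var_or_node with ⟨x, rfl⟩ | ⟨g, ts, rfl⟩
    · rw [subst_var, subst_var, h x ⟨[], rfl⟩]
    · rw [subst_node, subst_node]
      by_cases hj : ∃ k : Fin (S.arity g), j = k.val + 1
      · obtain ⟨k, rfl⟩ := hj
        rw [node_cons, node_cons]
        exact ih fun x ⟨q, hq⟩ => h x ⟨(k.val + 1) :: q, by simpa using hq⟩
      · push Not at hj
        rw [node_cons_none _ _ _ _ hj, node_cons_none _ _ _ _ hj]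

theorem eq_of_subst_eq {a : ITerm S X} {σ τ : X → ITerm S Y} (h : a.subst σ = a.subst τ)
    {x : X} (hx : x ∈ a.vars) : σ x = τ x := by
  obtain ⟨p, hp⟩ := hx
  refine ext_toFun fun q => ?_
  rw [← subst_toFun_var σ hp, ← subst_toFun_var τ hp, h]

/-- `t` is the instance of `a` under `τ` if it has the function symbols of `a` and its
subterms at the variable positions of `a` are those given by `τ`. -/
theorem eq_subst_of_matches {a : ITerm S X} {t : ITerm S Y} {τ : X → ITerm S Y}
    (hf : ∀ p f, a.toFun p = some (Sum.inl f) → t.toFun p = some (Sum.inl f))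
    (hv : ∀ p x, a.toFun p = some (Sum.inr x) → ∀ q, t.toFun (p ++ q) = (τ x).toFun q) :
    t = a.subst τ := by
  refine ext_toFun fun p => ?_
  induction p generalizing a t with
  | nil =>
    rcases a.var_or_node with ⟨x, rfl⟩ | ⟨g, ts, rfl⟩
    · simpa using hv [] x rfl []
    · simpa using hf [] g rfl
  | cons j p ih =>
    rcases a.var_or_node with ⟨x, rfl⟩ | ⟨g, ts, rfl⟩
    · simpa using hv [] x rfl (j :: p)
    · obtain ⟨us, rfl⟩ := eq_node_of_root (hf [] g rfl)
      rw [subst_node]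
      by_cases hj : ∃ k : Fin (S.arity g), j = k.val + 1
      · obtain ⟨k, rfl⟩ := hj
        rw [node_cons, node_cons]
        refine ih (fun p f h => ?_) fun p x h q => ?_
        · simpa using hf ((k.val + 1) :: p) f (by simpa using h)
        · simpa using hv ((k.val + 1) :: p) x (by simpa using h) q
      · push Not at hj
        rw [node_cons_none _ _ _ _ hj, node_cons_none _ _ _ _ hj]

theorem subst_subst {Z : Type*} (a : ITerm S X) (σ : X → ITerm S Y) (τ : Y → ITerm S Z) :
    (a.subst σ).subst τ = a.subst (fun x => (σ x).subst τ) := by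
  refine eq_subst_of_matches (fun p f h => subst_toFun_symb τ (subst_toFun_symb σ h))
    fun p x h q => ?_
  induction p generalizing a with
  | nil =>
    rw [eq_var_of_root h]
    simp
  | cons j p ih =>
    rcases a.var_or_node with ⟨y, rfl⟩ | ⟨g, ts, rfl⟩
    · simp at h
    · obtain ⟨i, rfl, -⟩ := node_cons_isSome (Option.isSome_iff_exists.2 ⟨_, h⟩)
      simp only [node_cons, subst_node, List.cons_append] at h ⊢
      exact ih _ h

theorem matches_pos {a : ITerm S X} {t : ITerm S Y}
    (hf : ∀ p f, a.toFun p = some (Sum.inl f) → t.toFun p = some (Sum.inl f)) {p : List ℕ}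
    (hp : p ∈ a.Pos) : p ∈ t.Pos := by
  rcases List.eq_nil_or_concat p with rfl | ⟨q, i, rfl⟩
  · exact t.nil_mem_pos
  · rw [List.concat_eq_append] at hp ⊢
    obtain ⟨f, h1, h2⟩ := (a.isTerm.2 q i).1 hp
    exact (t.isTerm.2 q i).2 ⟨f, hf q f h1, h2⟩

/-- No variable occurs twice. -/
def Linear (a : ITerm S X) : Prop :=
  ∀ (x : X) (p q : List ℕ), a.toFun p = some (Sum.inr x) → a.toFun q = some (Sum.inr x) → p = q

theorem Linear.of_node {f : S.Symb} {ts : Fin (S.arity f) → ITerm S X} (h : (node f ts).Linear)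
    (i : Fin (S.arity f)) : (ts i).Linear := by
  intro x p q hp hq
  have := h x ((i.val + 1) :: p) ((i.val + 1) :: q) (by simpa using hp) (by simpa using hq)
  simpa using this

theorem Linear.index_eq {f : S.Symb} {ts : Fin (S.arity f) → ITerm S X} (h : (node f ts).Linear)
    {i j : Fin (S.arity f)} {x : X} (hi : x ∈ (ts i).vars) (hj : x ∈ (ts j).vars) : i = j := by
  obtain ⟨p, hp⟩ := hi
  obtain ⟨q, hq⟩ := hj
  have := h x ((i.val + 1) :: p) ((j.val + 1) :: q) (by simpa using hp) (by simpa using hq)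
  have h1 : i.val + 1 = j.val + 1 := by simpa using (List.cons_eq_cons.1 this).1
  exact Fin.ext (by omega)

open Classical in
/-- A term that has all function symbols of a linear term `a` is an instance of `a`. -/
theorem Linear.exists_eq_subst {a : ITerm S X} (ha : a.Linear) {t : ITerm S X}
    (hf : ∀ p f, a.toFun p = some (Sum.inl f) → t.toFun p = some (Sum.inl f)) :
    ∃ τ : X → ITerm S X, t = a.subst τ ∧
      ∀ p x, a.toFun p = some (Sum.inr x) → τ x = t.subterm p := by
  let τ : X → ITerm S X := fun x =>
    if h : ∃ p, a.toFun p = some (Sum.inr x) then t.subterm h.choose else var x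
  have hτ : ∀ p x, a.toFun p = some (Sum.inr x) → τ x = t.subterm p := by
    intro p x hp
    have h : ∃ p, a.toFun p = some (Sum.inr x) := ⟨p, hp⟩
    simp only [τ, h, dif_pos]
    rw [ha x _ _ h.choose_spec hp]
  refine ⟨τ, eq_subst_of_matches hf fun p x hp q => ?_, hτ⟩
  rw [hτ p x hp, subterm_toFun (matches_pos hf (by simp [Pos, hp]))]

theorem subterm_subst_var (σ : X → ITerm S Y) {a : ITerm S X} {p : List ℕ} {x : X}
    (h : a.toFun p = some (Sum.inr x)) : (a.subst σ).subterm p = σ x := by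
  have hp : p ∈ (a.subst σ).Pos :=
    matches_pos (fun _ _ h => subst_toFun_symb σ h) (by simp [Pos, h])
  refine ext_toFun fun q => ?_
  rw [subterm_toFun hp, subst_toFun_var σ h]

theorem IsFinite.exists_length_lt {a : ITerm S X} (h : a.IsFinite) :
    ∃ n, ∀ p ∈ a.Pos, p.length < n := by
  obtain ⟨m, hm⟩ := (h.image List.length).bddAbove
  exact ⟨m + 1, fun p hp => Nat.lt_succ_of_le (hm ⟨p, hp, rfl⟩)⟩

/-! ### Corecursion -/

/-- The positions of the term generated from the state `a`. -/
def corecFun {A : Type*} (step : A → ITerm S X ⊕ (Σ f : S.Symb, Fin (S.arity f) → A)) :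
    A → List ℕ → Option (S.Symb ⊕ X)
  | a, [] =>
    match step a with
    | Sum.inl t => t.toFun []
    | Sum.inr ⟨f, _⟩ => some (Sum.inl f)
  | a, i :: p =>
    match step a with
    | Sum.inl t => t.toFun (i :: p)
    | Sum.inr ⟨f, n⟩ =>
      if h : 1 ≤ i ∧ i ≤ S.arity f then corecFun step (n ⟨i - 1, by omega⟩) p else none

theorem isTerm_corecFun {A : Type*} (step : A → ITerm S X ⊕ (Σ f : S.Symb, Fin (S.arity f) → A))
    (a : A) : IsTerm S (corecFun step a) := by
  have hroot : ∀ a, (corecFun step a []).isSome := by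
    intro a
    rcases h : step a with t | ⟨f, n⟩
    · simpa [corecFun, h] using t.isTerm.1
    · simp [corecFun, h]
  refine ⟨hroot a, fun p => ?_⟩
  induction p generalizing a with
  | nil =>
    intro i
    rcases h : step a with t | ⟨f, n⟩
    · simpa [corecFun, h] using t.isTerm.2 [] i
    · by_cases hi : 1 ≤ i ∧ i ≤ S.arity f
      · simpa [corecFun, h, hi] using hroot _
      · simp [corecFun, h, hi]
  | cons j p ih =>
    intro i
    rcases h : step a with t | ⟨f, n⟩
    · simpa [corecFun, h] using t.isTerm.2 (j :: p) i
    · by_cases hj : 1 ≤ j ∧ j ≤ S.arity f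
      · simpa [corecFun, h, hj] using ih _ i
      · simp [corecFun, h, hj]

/-- Corecursive definition of terms: if every state `a` either has a term allowed by `D`, or
a root symbol with successor states allowed by `N`, then there is an assignment of terms to states
that follows these choices. -/
theorem exists_corec {A : Type*} (D : A → ITerm S X → Prop)
    (N : A → (f : S.Symb) → (Fin (S.arity f) → A) → Prop)
    (h : ∀ a, (∃ t, D a t) ∨ ∃ f n, N a f n) :
    ∃ u : A → ITerm S X, ∀ a, D a (u a) ∨ ∃ f n, N a f n ∧ u a = node f (fun i => u (n i)) := by
  have h' : ∀ a, ∃ y : ITerm S X ⊕ (Σ f : S.Symb, Fin (S.arity f) → A),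
      Sum.elim (D a) (fun z => N a z.1 z.2) y := by
    intro a
    rcases h a with ⟨t, ht⟩ | ⟨f, n, hn⟩
    · exact ⟨Sum.inl t, ht⟩
    · exact ⟨Sum.inr ⟨f, n⟩, hn⟩
  choose step hstep using h'
  refine ⟨fun a => ⟨corecFun step a, isTerm_corecFun step a⟩, fun a => ?_⟩
  have ha := hstep a
  rcases hs : step a with t | ⟨f, n⟩
  · left
    rw [hs] at ha
    have e : (⟨corecFun step a, isTerm_corecFun step a⟩ : ITerm S X) = t :=
      ext_toFun fun p => by cases p <;> simp [corecFun, hs]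
    change D a ⟨corecFun step a, isTerm_corecFun step a⟩
    rw [e]
    exact ha
  · right
    rw [hs] at ha
    refine ⟨f, n, ha, ext_toFun fun p => ?_⟩
    cases p <;> simp [corecFun, hs, node]

end ITerm

/-! ### Lifting relations to immediate subterms -/

section Lift

variable {S : Signature.{u}} {X : Type v}

open ITerm

/-- Two terms are related by `Lift P` if they are the same variable, or have the same root symbol
and immediate subterms that are pairwise related by `P`. -/
inductive Lift (P : ITerm S X → ITerm S X → Prop) : ITerm S X → ITerm S X → Prop
  | var (x : X) : Lift P (ITerm.var x) (ITerm.var x)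
  | node (f : S.Symb) (ss ts : Fin (S.arity f) → ITerm S X) (h : ∀ i, P (ss i) (ts i)) :
      Lift P (ITerm.node f ss) (ITerm.node f ts)

variable {P Q : ITerm S X → ITerm S X → Prop}

theorem Lift.mono (h : ∀ a b, P a b → Q a b) {s t : ITerm S X} (hst : Lift P s t) :
    Lift Q s t := by
  cases hst with
  | var x => exact Lift.var x
  | node f ss ts hh => exact Lift.node f ss ts fun i => h _ _ (hh i)

theorem Lift.of_node_left {f : S.Symb} {ss : Fin (S.arity f) → ITerm S X} {t : ITerm S X}
    (h : Lift P (ITerm.node f ss) t) : ∃ ts, t = ITerm.node f ts ∧ ∀ i, P (ss i) (ts i) := by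
  generalize hs : ITerm.node f ss = s at h
  cases h with
  | var x => exact absurd hs.symm var_ne_node
  | node g ss' ts hh =>
    obtain rfl := node_root_inj hs
    obtain rfl := node_inj hs
    exact ⟨ts, rfl, hh⟩

theorem Lift.of_node_right {f : S.Symb} {ts : Fin (S.arity f) → ITerm S X} {s : ITerm S X}
    (h : Lift P s (ITerm.node f ts)) : ∃ ss, s = ITerm.node f ss ∧ ∀ i, P (ss i) (ts i) := by
  generalize ht : ITerm.node f ts = t at h
  cases h with
  | var x => exact absurd ht.symm var_ne_node
  | node g ss ts' hh =>
    obtain rfl := node_root_inj ht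
    obtain rfl := node_inj ht
    exact ⟨ss, rfl, hh⟩

theorem Lift.of_var_left {x : X} {t : ITerm S X} (h : Lift P (ITerm.var x) t) :
    t = ITerm.var x := by
  generalize hs : ITerm.var x = s at h
  cases h with
  | var y => rfl
  | node g ss' ts hh => exact absurd hs var_ne_node

theorem Lift.of_var_right {x : X} {t : ITerm S X} (h : Lift P t (ITerm.var x)) :
    t = ITerm.var x := by
  generalize hs : ITerm.var x = s at h
  cases h with
  | var y => rfl
  | node g ss' ts hh => exact absurd hs var_ne_node

theorem Lift.refl (h : ∀ a, P a a) (s : ITerm S X) : Lift P s s := by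
  rcases s.var_or_node with ⟨x, rfl⟩ | ⟨f, ts, rfl⟩
  · exact Lift.var x
  · exact Lift.node f ts ts fun i => h _

theorem Lift.comp {s t u : ITerm S X} (h : Lift P s t) (h' : Lift Q t u) :
    Lift (fun a c => ∃ b, P a b ∧ Q b c) s u := by
  cases h with
  | var x => rw [h'.of_var_left]; exact Lift.var x
  | node f ss ts hh =>
    obtain ⟨us, rfl, hu⟩ := h'.of_node_left
    exact Lift.node f ss us fun i => ⟨ts i, hh i, hu i⟩

theorem Lift.exists_of_comp {s u : ITerm S X}
    (h : Lift (fun a c => ∃ b, P a b ∧ Q b c) s u) : ∃ t, Lift P s t ∧ Lift Q t u := by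
  cases h with
  | var x => exact ⟨_, Lift.var x, Lift.var x⟩
  | node f ss us hh =>
    choose ts h1 h2 using hh
    exact ⟨_, Lift.node f ss ts h1, Lift.node f ts us h2⟩

theorem Lift.trans (hP : ∀ a b c, P a b → P b c → P a c) {s t u : ITerm S X} (h : Lift P s t)
    (h' : Lift P t u) : Lift P s u :=
  (h.comp h').mono fun _ _ ⟨_, h1, h2⟩ => hP _ _ _ h1 h2

theorem lift_iterate_succ (n : ℕ) (s t : ITerm S X) :
    Lift^[n + 1] P s t ↔ Lift (Lift^[n] P) s t := by
  rw [Function.iterate_succ_apply']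

theorem lift_iterate_mono (h : ∀ a b, P a b → Q a b) (n : ℕ) {s t : ITerm S X}
    (hst : Lift^[n] P s t) : Lift^[n] Q s t := by
  induction n generalizing s t with
  | zero => exact h _ _ hst
  | succ n ih =>
    rw [lift_iterate_succ] at hst ⊢
    exact hst.mono fun _ _ => ih

theorem lift_iterate_refl (h : ∀ a, P a a) (n : ℕ) (s : ITerm S X) : Lift^[n] P s s := by
  induction n generalizing s with
  | zero => exact h s
  | succ n ih =>
    rw [lift_iterate_succ]
    exact Lift.refl ih s

theorem lift_iterate_trans (hP : ∀ a b c, P a b → P b c → P a c) (n : ℕ) {s t u : ITerm S X}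
    (h : Lift^[n] P s t) (h' : Lift^[n] P t u) : Lift^[n] P s u := by
  induction n generalizing s t u with
  | zero => exact hP _ _ _ h h'
  | succ n ih =>
    rw [lift_iterate_succ] at h h' ⊢
    exact Lift.trans (P := Lift^[n] P) (fun _ _ _ => ih) h h'

theorem lift_iterate_exists_of_comp (n : ℕ) {s u : ITerm S X}
    (h : Lift^[n] (fun a c => ∃ b, P a b ∧ Q b c) s u) :
    ∃ t, Lift^[n] P s t ∧ Lift^[n] Q t u := by
  induction n generalizing s u with
  | zero => exact h
  | succ n ih =>
    rw [lift_iterate_succ] at h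
    obtain ⟨t, h1, h2⟩ := (h.mono fun _ _ => ih).exists_of_comp
    exact ⟨t, (lift_iterate_succ n _ _).2 h1, (lift_iterate_succ n _ _).2 h2⟩

/-- Terms related by `Lift^[n]` agree above depth `n`. -/
theorem lift_iterate_toFun {n : ℕ} {s t : ITerm S X} (h : Lift^[n] P s t) {p : List ℕ}
    (hp : p.length < n) : s.toFun p = t.toFun p := by
  induction n generalizing s t p with
  | zero => simp at hp
  | succ n ih =>
    rw [lift_iterate_succ] at h
    cases h with
    | var x => rfl
    | node f ss ts hh =>
      rcases p with _ | ⟨j, p⟩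
      · rfl
      · by_cases hj : ∃ k : Fin (S.arity f), j = k.val + 1
        · obtain ⟨k, rfl⟩ := hj
          rw [node_cons, node_cons]
          exact ih (hh k) (by simpa using hp)
        · push Not at hj
          rw [node_cons_none _ _ _ _ hj, node_cons_none _ _ _ _ hj]

/-- The subterms down to depth `n` of terms related by `Lift^[n] P` are again related. -/
theorem lift_iterate_subterm {n : ℕ} {s t : ITerm S X} (h : Lift^[n] P s t) {p : List ℕ}
    (hp : p.length ≤ n) (hs : p ∈ s.Pos) :
    p ∈ t.Pos ∧ Lift^[n - p.length] P (s.subterm p) (t.subterm p) := by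
  induction p generalizing n s t with
  | nil => exact ⟨t.nil_mem_pos, by simpa using h⟩
  | cons j p ih =>
    obtain ⟨n, rfl⟩ : ∃ m, n = m + 1 := ⟨n - 1, by simp at hp; omega⟩
    rw [lift_iterate_succ] at h
    cases h with
    | var x => simp [Pos] at hs
    | node f ss ts hh =>
      obtain ⟨i, rfl, hi⟩ := node_cons_isSome hs
      obtain ⟨h1, h2⟩ := ih (hh i) (by simpa using hp) hi
      refine ⟨cons_mem_pos_node.2 h1, ?_⟩
      rw [subterm_node hi, subterm_node h1]
      simpa using h2

/-- An instance of a finite linear term `a` is related by `Lift^[n] P`, for large `n`, only to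
instances of `a`. -/
theorem lift_iterate_subst_left {n : ℕ} {a t : ITerm S X} {σ : X → ITerm S X} (ha : a.Linear)
    (hn : ∀ p ∈ a.Pos, p.length < n) (hP : ∀ m s t, Lift^[m] P s t → P s t)
    (h : Lift^[n] P (a.subst σ) t) :
    ∃ τ : X → ITerm S X, t = a.subst τ ∧ ∀ x ∈ a.vars, P (σ x) (τ x) := by
  obtain ⟨τ, rfl, hτ⟩ := ha.exists_eq_subst (t := t) fun p f hp => by
    rw [← lift_iterate_toFun h (hn p (by simp [Pos, hp]))]
    exact subst_toFun_symb σ hp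
  refine ⟨τ, rfl, fun x ⟨p, hp⟩ => ?_⟩
  have hpos : p ∈ a.Pos := by simp [Pos, hp]
  have h1 := (lift_iterate_subterm h (hn p hpos).le
    (matches_pos (fun _ _ h => subst_toFun_symb σ h) hpos)).2
  rw [subterm_subst_var σ hp, subterm_subst_var τ hp] at h1
  exact hP _ _ _ h1

/-- The mirror image of `lift_iterate_subst_left`. -/
theorem lift_iterate_subst_right {n : ℕ} {a s : ITerm S X} {τ : X → ITerm S X} (ha : a.Linear)
    (hn : ∀ p ∈ a.Pos, p.length < n) (hP : ∀ m s t, Lift^[m] P s t → P s t)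
    (h : Lift^[n] P s (a.subst τ)) :
    ∃ σ : X → ITerm S X, s = a.subst σ ∧ ∀ x ∈ a.vars, P (σ x) (τ x) := by
  obtain ⟨σ, rfl, hσ⟩ := ha.exists_eq_subst (t := s) fun p f hp => by
    rw [lift_iterate_toFun h (hn p (by simp [Pos, hp]))]
    exact subst_toFun_symb τ hp
  refine ⟨σ, rfl, fun x ⟨p, hp⟩ => ?_⟩
  have hpos : p ∈ a.Pos := by simp [Pos, hp]
  have h1 := (lift_iterate_subterm h (hn p hpos).le
    (matches_pos (fun _ _ h => subst_toFun_symb σ h) hpos)).2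
  rw [subterm_subst_var σ hp, subterm_subst_var τ hp] at h1
  exact hP _ _ _ h1

end Lift

namespace ITRS

variable {S : Signature.{u}} {X : Type v} {R : ITRS S X}

open ITerm Relation

/-! ### Rewrite steps on nodes -/

/-- Contraction of a redex at the root. -/
def RootStep (R : ITRS S X) (s t : ITerm S X) : Prop :=
  ∃ ρ ∈ R.rules, ∃ σ : X → ITerm S X, s = ρ.lhs.subst σ ∧ t = ρ.rhs.subst σ

theorem stepAt_nil {s t : ITerm S X} : R.StepAt [] s t ↔ R.RootStep s t := by
  simp [StepAt, RootStep, nil_mem_pos]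

theorem stepAt_node {f : S.Symb} {ss : Fin (S.arity f) → ITerm S X} {i : Fin (S.arity f)}
    {p : List ℕ} {t' : ITerm S X} (h : R.StepAt p (ss i) t') :
    R.StepAt ((i.val + 1) :: p) (node f ss) (node f (Function.update ss i t')) := by
  obtain ⟨ρ, hρ, σ, hp, h1, rfl⟩ := h
  exact ⟨ρ, hρ, σ, cons_mem_pos_node.2 hp, by rw [subterm_node hp, h1], by rw [replaceAt_node hp]⟩

theorem StepAt.exists_of_cons {j : ℕ} {p : List ℕ} {s t : ITerm S X}
    (h : R.StepAt (j :: p) s t) :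
    ∃ f ss i t', s = node f ss ∧ j = i.val + 1 ∧ R.StepAt p (ss i) t' ∧
      t = node f (Function.update ss i t') := by
  obtain ⟨ρ, hρ, σ, hp, h1, rfl⟩ := h
  rcases s.var_or_node with ⟨x, rfl⟩ | ⟨f, ss, rfl⟩
  · simp [Pos] at hp
  · obtain ⟨i, rfl, hi⟩ := node_cons_isSome hp
    exact ⟨f, ss, i, _, rfl, rfl, ⟨ρ, hρ, σ, hi, by rw [← subterm_node hi, h1], rfl⟩,
      replaceAt_node hi _⟩

/-- A rewrite step at depth at least `n`. -/
def StepGe (R : ITRS S X) (n : ℕ) (s t : ITerm S X) : Prop :=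
  ∃ p : List ℕ, n ≤ p.length ∧ R.StepAt p s t

theorem stepGe_zero {s t : ITerm S X} : R.StepGe 0 s t ↔ R.Step s t := by
  simp [StepGe, Step]

/-- Finitely many steps in each of finitely many components can be done one after the other. -/
theorem reflTransGen_update {ι : Type*} [Finite ι] [DecidableEq ι] {α : Type*}
    {r : α → α → Prop} {a b : ι → α} (h : ∀ i, ReflTransGen r (a i) (b i)) :
    ReflTransGen (fun x y : ι → α => ∃ i t, r (x i) t ∧ y = Function.update x i t) a b := by
  classical
  have := Fintype.ofFinite ι
  have key : ∀ s : Finset ι,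
      ReflTransGen (fun x y : ι → α => ∃ i t, r (x i) t ∧ y = Function.update x i t) a
        (s.piecewise b a) := by
    intro s
    induction s using Finset.induction_on with
    | empty => simpa using ReflTransGen.refl
    | insert i s hi ih =>
      refine ih.trans ?_
      rw [Finset.piecewise_insert]
      have e : s.piecewise b a = Function.update (s.piecewise b a) i (a i) := by
        rw [eq_comm, Function.update_eq_self_iff]
        simp [hi]
      conv_lhs => rw [e]
      refine ReflTransGen.lift (fun t => Function.update (s.piecewise b a) i t) ?_ _ _ (h i)
      intro t t' htt
      exact ⟨i, t', by simpa using htt, by simp⟩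
  simpa using key Finset.univ

theorem reflTransGen_stepGe_node {n : ℕ} {f : S.Symb} {ss ts : Fin (S.arity f) → ITerm S X}
    (h : ∀ i, ReflTransGen (R.StepGe n) (ss i) (ts i)) :
    ReflTransGen (R.StepGe (n + 1)) (node f ss) (node f ts) := by
  refine ReflTransGen.lift (node f) ?_ _ _ (reflTransGen_update h)
  rintro a b ⟨i, t, ⟨p, hp, hs⟩, rfl⟩
  exact ⟨_, by simpa using hp, stepAt_node hs⟩

theorem reflTransGen_stepGe_of_lift {n : ℕ} {s t : ITerm S X}
    (h : Lift^[n] (ReflTransGen R.Step) s t) : ReflTransGen (R.StepGe n) s t := by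
  induction n generalizing s t with
  | zero => exact ReflTransGen.mono (fun _ _ => stepGe_zero.2) _ _ h
  | succ n ih =>
    rw [lift_iterate_succ] at h
    cases h with
    | var x => exact ReflTransGen.refl
    | node f ss ts hh => exact reflTransGen_stepGe_node fun i => ih (hh i)

theorem reflTransGen_step_of_stepGe {n : ℕ} {s t : ITerm S X}
    (h : ReflTransGen (R.StepGe n) s t) : ReflTransGen R.Step s t :=
  ReflTransGen.mono (fun _ _ ⟨p, _, hp⟩ => ⟨p, hp⟩) _ _ h

/-! ### Coinductive infinitary rewriting -/

/-- The coinductive rewrite relation: `s` rewrites in finitely many steps to a term with the same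
root as `t`, and so do, again and again, the immediate subterms. It is the greatest relation with
this property. -/
def Red (R : ITRS S X) (s t : ITerm S X) : Prop :=
  ∃ P : ITerm S X → ITerm S X → Prop,
    (∀ a b, P a b → ∃ a', ReflTransGen R.Step a a' ∧ Lift P a' b) ∧ P s t

theorem Red.exists_lift {s t : ITerm S X} (h : R.Red s t) :
    ∃ s', ReflTransGen R.Step s s' ∧ Lift R.Red s' t := by
  obtain ⟨P, hP, hst⟩ := h
  obtain ⟨s', h1, h2⟩ := hP _ _ hst
  exact ⟨s', h1, h2.mono fun a b hab => ⟨P, hP, hab⟩⟩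

theorem Red.of_lift {s s' t : ITerm S X} (h : ReflTransGen R.Step s s') (h' : Lift R.Red s' t) :
    R.Red s t := by
  refine ⟨fun a b => R.Red a b ∨ ∃ a', ReflTransGen R.Step a a' ∧ Lift R.Red a' b, ?_,
    Or.inr ⟨s', h, h'⟩⟩
  rintro a b (hab | ⟨a', h1, h2⟩)
  · obtain ⟨a', h1, h2⟩ := hab.exists_lift
    exact ⟨a', h1, h2.mono fun _ _ => Or.inl⟩
  · exact ⟨a', h1, h2.mono fun _ _ => Or.inl⟩

/-- The coinduction principle: to show that `P` is contained in `Red`, it suffices to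
unfold `P` once and to end in `P` or in `Red`. -/
theorem Red.coinduct (P : ITerm S X → ITerm S X → Prop)
    (hP : ∀ a b, P a b → ∃ a', ReflTransGen R.Step a a' ∧ Lift (fun s t => P s t ∨ R.Red s t) a' b)
    {s t : ITerm S X} (h : P s t) : R.Red s t := by
  refine ⟨fun a b => P a b ∨ R.Red a b, ?_, Or.inl h⟩
  rintro a b (hab | hab)
  · exact hP a b hab
  · obtain ⟨a', h1, h2⟩ := hab.exists_lift
    exact ⟨a', h1, h2.mono fun _ _ => Or.inr⟩

theorem Red.refl (s : ITerm S X) : R.Red s s :=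
  Red.coinduct (fun a b => a = b)
    (by rintro a _ rfl; exact ⟨a, ReflTransGen.refl, Lift.refl (fun _ => Or.inl rfl) a⟩) rfl

theorem Red.head {s s' t : ITerm S X} (h : ReflTransGen R.Step s s') (h' : R.Red s' t) :
    R.Red s t := by
  obtain ⟨s'', h1, h2⟩ := h'.exists_lift
  exact Red.of_lift (h.trans h1) h2

theorem Red.of_steps {s t : ITerm S X} (h : ReflTransGen R.Step s t) : R.Red s t :=
  Red.head h (Red.refl t)

theorem Red.of_lift_refl {s t : ITerm S X} (h : Lift R.Red s t) : R.Red s t :=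
  Red.of_lift ReflTransGen.refl h

theorem Red.of_lift_iterate (n : ℕ) {s t : ITerm S X} (h : Lift^[n] R.Red s t) : R.Red s t := by
  induction n generalizing s t with
  | zero => exact h
  | succ n ih =>
    rw [lift_iterate_succ] at h
    exact Red.of_lift_refl (h.mono fun _ _ => ih)

theorem Red.of_lift_iterate' (m : ℕ) (s t : ITerm S X) (h : Lift^[m] R.Red s t) : R.Red s t :=
  Red.of_lift_iterate m h

/-- One more level of an infinitary reduction at depth at least `n` is reached by finitely many
steps at depth at least `n`. -/
theorem exists_stepGe_of_lift_iterate {n : ℕ} {s t : ITerm S X} (h : Lift^[n] R.Red s t) :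
    ∃ s', ReflTransGen (R.StepGe n) s s' ∧ Lift^[n + 1] R.Red s' t := by
  obtain ⟨s', h1, h2⟩ := lift_iterate_exists_of_comp n
    (lift_iterate_mono (fun _ _ hab => Red.exists_lift hab) n h)
  refine ⟨s', reflTransGen_stepGe_of_lift h1, ?_⟩
  rw [Function.iterate_succ_apply]
  exact h2

theorem exists_stepGe_lift_iterate {n m : ℕ} (hnm : n ≤ m) {s t : ITerm S X}
    (h : Lift^[n] R.Red s t) :
    ∃ s', ReflTransGen (R.StepGe n) s s' ∧ Lift^[m] R.Red s' t := by
  induction m, hnm using Nat.le_induction with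
  | base => exact ⟨s, ReflTransGen.refl, h⟩
  | succ m hm ih =>
    obtain ⟨s', h1, h2⟩ := ih
    obtain ⟨s'', h3, h4⟩ := exists_stepGe_of_lift_iterate h2
    exact ⟨s'', h1.trans (ReflTransGen.mono (fun _ _ ⟨p, hp, h⟩ => ⟨p, hm.trans hp, h⟩) _ _ h3), h4⟩

theorem Red.subst {r : ITerm S X} {σ τ : X → ITerm S X} (h : ∀ x ∈ r.vars, R.Red (σ x) (τ x)) :
    R.Red (r.subst σ) (r.subst τ) := by
  refine Red.coinduct (fun a b => ∃ r : ITerm S X, (∀ x ∈ r.vars, R.Red (σ x) (τ x)) ∧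
    a = r.subst σ ∧ b = r.subst τ) ?_ ⟨r, h, rfl, rfl⟩
  rintro _ _ ⟨r, hr, rfl, rfl⟩
  rcases r.var_or_node with ⟨x, rfl⟩ | ⟨f, rs, rfl⟩
  · obtain ⟨a', h1, h2⟩ := (hr x ⟨[], rfl⟩).exists_lift
    refine ⟨a', by simpa using h1, ?_⟩
    rw [subst_var]
    exact h2.mono fun _ _ => Or.inr
  · refine ⟨_, ReflTransGen.refl, ?_⟩
    rw [subst_node, subst_node]
    exact Lift.node _ _ _ fun i => Or.inl
      ⟨rs i, fun x ⟨q, hq⟩ => hr x ⟨(i.val + 1) :: q, by simpa using hq⟩, rfl, rfl⟩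

/-- An instance of a term that is not a variable has no reduction at the root when only the
substitution is rewritten. -/
theorem Red.lift_subst {r : ITerm S X} (hr : ¬ r.IsVar) {σ τ : X → ITerm S X}
    (h : ∀ x ∈ r.vars, R.Red (σ x) (τ x)) : Lift R.Red (r.subst σ) (r.subst τ) := by
  rcases r.var_or_node with ⟨x, rfl⟩ | ⟨f, rs, rfl⟩
  · exact absurd ⟨x, rfl⟩ hr
  · rw [subst_node, subst_node]
    exact Lift.node _ _ _ fun i => Red.subst fun x ⟨q, hq⟩ =>
      h x ⟨(i.val + 1) :: q, by simpa using hq⟩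

/-! ### Compression -/

/-- A step after an infinitary reduction can be absorbed: its redex pattern is finite, hence
present after finitely many steps of the reduction. -/
theorem Red.tail_stepAt (hR : R.LeftLinear) {s t t' : ITerm S X} {p : List ℕ} (h : R.Red s t)
    (ht : R.StepAt p t t') : R.Red s t' := by
  induction p generalizing s t t' with
  | nil =>
    obtain ⟨ρ, hρ, τ, rfl, rfl⟩ := stepAt_nil.1 ht
    obtain ⟨n, hn⟩ := ρ.lhs_finite.exists_length_lt
    obtain ⟨s', h1, h2⟩ := exists_stepGe_lift_iterate (n := 0) (Nat.zero_le n) h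
    obtain ⟨σ, rfl, hσ⟩ := lift_iterate_subst_right (hR ρ hρ) hn Red.of_lift_iterate' h2
    refine Red.head (reflTransGen_step_of_stepGe h1) (Red.head (ReflTransGen.single
      ⟨[], stepAt_nil.2 ⟨ρ, hρ, σ, rfl, rfl⟩⟩) (Red.subst fun x hx => hσ x (ρ.vars_subset hx)))
  | cons j p ih =>
    obtain ⟨f, ts, i, t'', rfl, rfl, hi, rfl⟩ := ht.exists_of_cons
    obtain ⟨s', h1, h2⟩ := h.exists_lift
    obtain ⟨ss, rfl, hss⟩ := h2.of_node_right
    refine Red.of_lift h1 (Lift.node _ _ _ fun k => ?_)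
    by_cases hk : k = i
    · subst hk
      simpa using ih (hss k) hi
    · simpa [hk] using hss k

theorem Red.tail (hR : R.LeftLinear) {s t t' : ITerm S X} (h : R.Red s t)
    (ht : ReflTransGen R.Step t t') : R.Red s t' := by
  induction ht with
  | refl => exact h
  | tail _ hs ih =>
    obtain ⟨p, hp⟩ := hs
    exact ih.tail_stepAt hR hp

theorem Red.trans (hR : R.LeftLinear) {s t u : ITerm S X} (h : R.Red s t) (h' : R.Red t u) :
    R.Red s u := by
  refine Red.coinduct (fun a c => ∃ b, R.Red a b ∧ R.Red b c) ?_ ⟨t, h, h'⟩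
  rintro a c ⟨b, hab, hbc⟩
  obtain ⟨b', h1, h2⟩ := hbc.exists_lift
  obtain ⟨a', h3, h4⟩ := (hab.tail hR h1).exists_lift
  exact ⟨a', h3, (h4.comp h2).mono fun _ _ => Or.inl⟩

/-! ### Parallel steps -/

/-- The parallel step relation: contraction of a possibly infinite set of redexes at pairwise
disjoint positions. It is the greatest relation such that a related pair is a root step
or is lifted from the immediate subterms. -/
def Par (R : ITRS S X) (s t : ITerm S X) : Prop :=
  ∃ P : ITerm S X → ITerm S X → Prop,
    (∀ a b, P a b → R.RootStep a b ∨ Lift P a b) ∧ P s t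

theorem Par.cases {s t : ITerm S X} (h : R.Par s t) : R.RootStep s t ∨ Lift R.Par s t := by
  obtain ⟨P, hP, hst⟩ := h
  exact (hP _ _ hst).imp_right fun h => h.mono fun a b hab => ⟨P, hP, hab⟩

theorem Par.coinduct (P : ITerm S X → ITerm S X → Prop)
    (hP : ∀ a b, P a b → R.RootStep a b ∨ Lift (fun s t => P s t ∨ R.Par s t) a b)
    {s t : ITerm S X} (h : P s t) : R.Par s t := by
  refine ⟨fun a b => P a b ∨ R.Par a b, ?_, Or.inl h⟩
  rintro a b (hab | hab)
  · exact hP a b hab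
  · exact hab.cases.imp_right fun h => h.mono fun _ _ => Or.inr

theorem Par.refl (s : ITerm S X) : R.Par s s :=
  Par.coinduct (fun a b => a = b)
    (by rintro a _ rfl; exact Or.inr (Lift.refl (fun _ => Or.inl rfl) a)) rfl

theorem Par.of_rootStep {s t : ITerm S X} (h : R.RootStep s t) : R.Par s t :=
  Par.coinduct R.RootStep (fun _ _ h => Or.inl h) h

theorem Par.of_lift {s t : ITerm S X} (h : Lift R.Par s t) : R.Par s t :=
  Par.coinduct (Lift R.Par) (fun _ _ h => Or.inr (h.mono fun _ _ => Or.inr)) h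

theorem Par.of_stepAt {p : List ℕ} {s t : ITerm S X} (h : R.StepAt p s t) : R.Par s t := by
  induction p generalizing s t with
  | nil => exact Par.of_rootStep (stepAt_nil.1 h)
  | cons j p ih =>
    obtain ⟨f, ts, i, t'', rfl, rfl, hi, rfl⟩ := h.exists_of_cons
    refine Par.of_lift (Lift.node _ _ _ fun k => ?_)
    by_cases hk : k = i
    · subst hk
      simpa using ih hi
    · simpa [hk] using Par.refl _

theorem Par.red {s t : ITerm S X} (h : R.Par s t) : R.Red s t := by
  refine Red.coinduct R.Par (fun a b hab => ?_) h
  rcases hab.cases with h1 | h1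
  · exact ⟨b, ReflTransGen.single ⟨[], stepAt_nil.2 h1⟩, Lift.refl (fun a => Or.inl (Par.refl a)) b⟩
  · exact ⟨a, ReflTransGen.refl, h1.mono fun _ _ => Or.inl⟩

theorem Par.subst {r : ITerm S X} {σ τ : X → ITerm S X} (h : ∀ x ∈ r.vars, R.Par (σ x) (τ x)) :
    R.Par (r.subst σ) (r.subst τ) := by
  refine Par.coinduct (fun a b => ∃ r : ITerm S X, (∀ x ∈ r.vars, R.Par (σ x) (τ x)) ∧
    a = r.subst σ ∧ b = r.subst τ) ?_ ⟨r, h, rfl, rfl⟩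
  rintro _ _ ⟨r, hr, rfl, rfl⟩
  rcases r.var_or_node with ⟨x, rfl⟩ | ⟨f, rs, rfl⟩
  · rw [subst_var, subst_var]
    exact (hr x ⟨[], rfl⟩).cases.imp_right fun h => h.mono fun _ _ => Or.inr
  · right
    rw [subst_node, subst_node]
    exact Lift.node _ _ _ fun i => Or.inl
      ⟨rs i, fun x ⟨q, hq⟩ => hr x ⟨(i.val + 1) :: q, by simpa using hq⟩, rfl, rfl⟩

end ITRS

/-! ### Most general common instances and critical pairs -/

namespace ITerm

variable {S : Signature.{u}} {X : Type v} {Y : Type w}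

theorem pos_subset_pos_subst (a : ITerm S X) (σ : X → ITerm S Y) {p : List ℕ} (hp : p ∈ a.Pos) :
    p ∈ (a.subst σ).Pos :=
  matches_pos (fun _ _ h => subst_toFun_symb σ h) hp

theorem subst_subterm {a : ITerm S X} {p : List ℕ} (hp : p ∈ a.Pos) (σ : X → ITerm S Y) :
    (a.subst σ).subterm p = (a.subterm p).subst σ := by
  have hp' := a.pos_subset_pos_subst σ hp
  refine eq_subst_of_matches (fun q f hq => ?_) fun q x hq r => ?_
  · rw [subterm_toFun hp] at hq
    rw [subterm_toFun hp']
    exact subst_toFun_symb σ hq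
  · rw [subterm_toFun hp] at hq
    rw [subterm_toFun hp', ← List.append_assoc]
    exact subst_toFun_var σ hq r

theorem subst_replaceAt {a : ITerm S X} {p : List ℕ} (hp : p ∈ a.Pos) (b : ITerm S X)
    (σ : X → ITerm S Y) :
    (a.replaceAt p b).subst σ = (a.subst σ).replaceAt p (b.subst σ) := by
  induction p generalizing a with
  | nil => simp
  | cons j p ih =>
    rcases a.var_or_node with ⟨x, rfl⟩ | ⟨f, ts, rfl⟩
    · simp [Pos] at hp
    · obtain ⟨i, rfl, hi⟩ := node_cons_isSome hp
      rw [replaceAt_node hi, subst_node, subst_node,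
        replaceAt_node ((ts i).pos_subset_pos_subst σ hi)]
      congr 1
      funext k
      by_cases hk : k = i
      · subst hk
        simp [ih hi]
      · simp [hk]

theorem IsFinite.finite_vars {a : ITerm S X} (h : a.IsFinite) : a.vars.Finite := by
  refine Set.Finite.subset (Set.Finite.preimage (f := fun x : X => some (Sum.inr (α := S.Symb) x))
    (fun x _ y _ hxy => by simpa using hxy) (h.image a.toFun)) ?_
  rintro x ⟨p, hp⟩
  exact ⟨p, by simp [Pos, hp], hp⟩

theorem exists_injective_avoiding [Infinite X] {F : Set X} (hF : F.Finite) :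
    ∃ e : List ℕ → X, Function.Injective e ∧ ∀ p, e p ∉ F := by
  have : Infinite ↥(Fᶜ) := hF.infinite_compl.to_subtype
  let g := Infinite.natEmbedding ↥(Fᶜ)
  refine ⟨fun p => (g (Encodable.encode p)).1, fun p q h => ?_, fun p => (g _).2⟩
  exact Encodable.encode_injective (g.injective (Subtype.ext h))

open Classical in
/-- The superposition of two terms that have a common instance: a position carries a function
symbol if it does so in one of the terms, and is labelled with its own fresh variable otherwise. -/
theorem exists_superposition {a b : ITerm S X} (e : List ℕ → X) {σ τ : X → ITerm S X}
    (h : a.subst σ = b.subst τ) :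
    ∃ c : ITerm S X,
      (∀ p f, c.toFun p = some (Sum.inl f) ↔
        a.toFun p = some (Sum.inl f) ∨ b.toFun p = some (Sum.inl f)) ∧
      (∀ p x, c.toFun p = some (Sum.inr x) → x = e p ∧ (p ∈ a.Pos ∨ p ∈ b.Pos)) := by
  let F : List ℕ → Option (S.Symb ⊕ X) := fun p =>
    if h : ∃ f, a.toFun p = some (Sum.inl f) ∨ b.toFun p = some (Sum.inl f) then
      some (Sum.inl h.choose)
    else if p ∈ a.Pos ∨ p ∈ b.Pos then some (Sum.inr (e p)) else none
  have hval : ∀ p f, a.toFun p = some (Sum.inl f) ∨ b.toFun p = some (Sum.inl f) →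
      (a.subst σ).toFun p = some (Sum.inl f) := by
    rintro p f (hf | hf)
    · exact subst_toFun_symb σ hf
    · rw [h]
      exact subst_toFun_symb τ hf
  have hF : ∀ p f, F p = some (Sum.inl f) ↔
      a.toFun p = some (Sum.inl f) ∨ b.toFun p = some (Sum.inl f) := by
    intro p f
    by_cases hp : ∃ f, a.toFun p = some (Sum.inl f) ∨ b.toFun p = some (Sum.inl f)
    · have h1 : F p = some (Sum.inl hp.choose) := by simp only [F, hp, dif_pos]
      rw [h1]
      constructor
      · intro h2
        have h3 : hp.choose = f := by simpa using h2
        rw [← h3]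
        exact hp.choose_spec
      · intro h2
        have h3 := hval p _ hp.choose_spec
        rw [hval p f h2] at h3
        exact h3.symm
    · have h1 : F p = if p ∈ a.Pos ∨ p ∈ b.Pos then some (Sum.inr (e p)) else none := by
        simp only [F, hp, dif_neg, not_false_eq_true]
      rw [h1]
      constructor
      · intro h2
        split_ifs at h2
        simp at h2
      · intro h2
        exact absurd ⟨f, h2⟩ hp
  have hsome : ∀ p, (F p).isSome ↔ p ∈ a.Pos ∨ p ∈ b.Pos := by
    intro p
    by_cases hp : ∃ f, a.toFun p = some (Sum.inl f) ∨ b.toFun p = some (Sum.inl f)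
    · obtain ⟨f, hf⟩ := hp
      rw [(hF p f).2 hf]
      rcases hf with hf | hf <;> simp [Pos, hf]
    · have h1 : F p = if p ∈ a.Pos ∨ p ∈ b.Pos then some (Sum.inr (e p)) else none := by
        simp only [F, hp, dif_neg, not_false_eq_true]
      rw [h1]
      split_ifs with h2 <;> simp [h2]
  refine ⟨⟨F, (hsome []).2 (Or.inl a.nil_mem_pos), fun p i => ?_⟩, hF, fun p x hx => ?_⟩
  · rw [hsome]
    constructor
    · rintro (h1 | h1)
      · obtain ⟨f, hf, hi⟩ := (a.isTerm.2 p i).1 h1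
        exact ⟨f, (hF p f).2 (Or.inl hf), hi⟩
      · obtain ⟨f, hf, hi⟩ := (b.isTerm.2 p i).1 h1
        exact ⟨f, (hF p f).2 (Or.inr hf), hi⟩
    · rintro ⟨f, hf, hi⟩
      rcases (hF p f).1 hf with hf | hf
      · exact Or.inl ((a.isTerm.2 p i).2 ⟨f, hf, hi⟩)
      · exact Or.inr ((b.isTerm.2 p i).2 ⟨f, hf, hi⟩)
  · change F p = _ at hx
    have h2 := (hsome p).1 (by rw [hx]; rfl)
    by_cases hp : ∃ f, a.toFun p = some (Sum.inl f) ∨ b.toFun p = some (Sum.inl f)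
    · simp only [F, hp, dif_pos] at hx
      simp at hx
    · simp only [F, hp, h2, dif_neg, not_false_eq_true, if_true] at hx
      exact ⟨by simpa using hx.symm, h2⟩

open Classical in
/-- Two linear terms with a common instance have a most general one, whose variables can be chosen
among any infinite supply of fresh variables. -/
theorem Linear.exists_mostGeneral {a b : ITerm S X} (ha : a.Linear) (hb : b.Linear)
    {e : List ℕ → X} (he : Function.Injective e) {σ' τ' : X → ITerm S X}
    (h : a.subst σ' = b.subst τ') :
    ∃ σ τ : X → ITerm S X, IsMostGeneralCommonInstance a b σ τ ∧
      (∀ x, x ∉ a.vars → σ x = var x) ∧ (a.subst σ).vars ⊆ Set.range e := by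
  obtain ⟨c, hc1, hc2⟩ := exists_superposition e h
  obtain ⟨σ, hσ, -⟩ := ha.exists_eq_subst (t := c) fun p f hp => (hc1 p f).2 (Or.inl hp)
  obtain ⟨τ, hτ, -⟩ := hb.exists_eq_subst (t := c) fun p f hp => (hc1 p f).2 (Or.inr hp)
  have hσ2 : a.subst (fun x => if x ∈ a.vars then σ x else var x) = c := by
    rw [hσ]
    exact subst_congr fun x hx => by simp [hx]
  -- The instance `a.subst σ₁` determines what has to be substituted for the fresh variable of
  -- each position, as distinct positions have distinct fresh variables.
  refine ⟨fun x => if x ∈ a.vars then σ x else var x, τ, ⟨hσ2.trans hτ, ?_⟩,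
    fun x hx => by simp [hx], ?_⟩
  · intro σ₁ τ₁ h₁
    rw [hσ2]
    refine ⟨fun y => if hy : ∃ p, e p = y then (a.subst σ₁).subterm hy.choose else var y, ?_⟩
    refine eq_subst_of_matches (fun p f hp => ?_) fun p x hp q => ?_
    · rcases (hc1 p f).1 hp with h2 | h2
      · exact subst_toFun_symb _ h2
      · rw [h₁]
        exact subst_toFun_symb _ h2
    · obtain ⟨rfl, h2⟩ := hc2 p x hp
      have hy : ∃ q, e q = e p := ⟨p, rfl⟩
      have hpos : p ∈ (a.subst σ₁).Pos := by
        rcases h2 with h2 | h2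
        · exact a.pos_subset_pos_subst _ h2
        · rw [h₁]
          exact b.pos_subset_pos_subst _ h2
      simp only [hy, dif_pos]
      rw [he hy.choose_spec, subterm_toFun hpos]
  · rw [hσ2]
    rintro x ⟨p, hp⟩
    exact ⟨p, (hc2 p x hp).1.symm⟩

end ITerm

namespace ITRS

variable {S : Signature.{u}} {X : Type v} {R : ITRS S X}

open ITerm Relation

/-- In a weakly orthogonal system, contracting a redex that overlaps with a redex at
the root has the same result as contracting the latter. -/
theorem WeaklyOrthogonal.overlap [Infinite X] (hR : R.WeaklyOrthogonal) {ρ₁ ρ₂ : IRule S X}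
    (h₁ : ρ₁ ∈ R.rules) (h₂ : ρ₂ ∈ R.rules) {p : List ℕ} {f : S.Symb}
    (hp : ρ₁.lhs.toFun p = some (Sum.inl f)) {σ' τ' : X → ITerm S X}
    (h : (ρ₁.lhs.subst σ').subterm p = ρ₂.lhs.subst τ') :
    (ρ₁.lhs.subst σ').replaceAt p (ρ₂.rhs.subst τ') = ρ₁.rhs.subst σ' := by
  classical
  have hpos : p ∈ ρ₁.lhs.Pos := by simp [Pos, hp]
  have hlin : (ρ₁.lhs.subterm p).Linear := by
    intro x q r hq hr
    rw [subterm_toFun hpos] at hq hr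
    simpa using hR.1 ρ₁ h₁ x _ _ hq hr
  have hout : (ρ₁.lhs.varsOutside p).Finite := ρ₁.lhs_finite.finite_vars.subset
    fun x ⟨q, _, hq⟩ => ⟨q, hq⟩
  obtain ⟨e, he, he'⟩ := exists_injective_avoiding hout
  rw [subst_subterm hpos] at h
  obtain ⟨σ, τ, hmg, hid, hvars⟩ := hlin.exists_mostGeneral (hR.1 ρ₂ h₂) he h
  have hdisj : Disjoint ((ρ₁.lhs.subterm p).subst σ).vars (ρ₁.lhs.varsOutside p) := by
    refine Set.disjoint_left.2 fun x hx hx' => ?_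
    obtain ⟨q, rfl⟩ := hvars hx
    exact he' q hx'
  have htriv := hR.2 ρ₁ h₁ ρ₂ h₂ _ _ ⟨p, f, σ, τ, hp, hmg, hid, hdisj, rfl, rfl⟩
  obtain ⟨δ, hδ⟩ := hmg.2 σ' τ' h
  -- `δ` acts correctly only on the variables of the most general instance; all other variables of
  -- the critical pair are those of the context, where `σ` is the identity.
  let δ' : X → ITerm S X := fun x =>
    if x ∈ ((ρ₁.lhs.subterm p).subst σ).vars then δ x else σ' x
  have hδ' : (ρ₁.lhs.subterm p).subst σ' = ((ρ₁.lhs.subterm p).subst σ).subst δ' := by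
    rw [hδ]
    exact subst_congr fun x hx => by simp [δ', hx]
  have hσ : ∀ x ∈ ρ₁.lhs.vars, σ' x = (σ x).subst δ' := by
    rintro x ⟨q, hq⟩
    by_cases hx : x ∈ (ρ₁.lhs.subterm p).vars
    · rw [subst_subst] at hδ'
      exact eq_of_subst_eq hδ' hx
    · have hx' : x ∈ ρ₁.lhs.varsOutside p := by
        refine ⟨q, ?_, hq⟩
        rintro ⟨r, rfl⟩
        exact hx ⟨r, by rw [subterm_toFun hpos, hq]⟩
      rw [hid x hx, subst_var]
      simp [δ', Set.disjoint_right.1 hdisj hx']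
  have hτ : ∀ x ∈ ρ₂.lhs.vars, τ' x = (τ x).subst δ' := by
    intro x hx
    have e : ρ₂.lhs.subst τ' = ρ₂.lhs.subst (fun x => (τ x).subst δ') := by
      rw [← h, hδ', hmg.1, subst_subst]
    exact eq_of_subst_eq e hx
  have e1 : ρ₁.lhs.subst σ' = (ρ₁.lhs.subst σ).subst δ' := by
    rw [subst_subst]
    exact subst_congr hσ
  have e2 : ρ₂.rhs.subst τ' = (ρ₂.rhs.subst τ).subst δ' := by
    rw [subst_subst]
    exact subst_congr fun x hx => hτ x (ρ₂.vars_subset hx)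
  have e3 : ρ₁.rhs.subst σ' = (ρ₁.rhs.subst σ).subst δ' := by
    rw [subst_subst]
    exact subst_congr fun x hx => hσ x (ρ₁.vars_subset hx)
  rw [e1, e2, e3, ← subst_replaceAt (ρ₁.lhs.pos_subset_pos_subst σ hpos), htriv]

end ITRS

namespace ITRS

variable {S : Signature.{u}} {X : Type v} {R : ITRS S X}

open ITerm Relation

/-! ### Parallel steps against single steps -/

open Classical in
/-- A step below a variable of a linear term rewrites the substitution at this variable. -/
theorem StepAt.subst_of_var {a : ITerm S X} (ha : a.Linear) {v q : List ℕ} {x : X}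
    (hv : a.toFun v = some (Sum.inr x)) {σ : X → ITerm S X} {s : ITerm S X}
    (h : R.StepAt (v ++ q) (a.subst σ) s) :
    ∃ t, R.StepAt q (σ x) t ∧ s = a.subst (Function.update σ x t) := by
  induction v generalizing a s with
  | nil =>
    obtain rfl := eq_var_of_root hv
    exact ⟨s, by simpa using h, by simp⟩
  | cons j v ih =>
    rcases a.var_or_node with ⟨y, rfl⟩ | ⟨f, as, rfl⟩
    · simp at hv
    · rw [subst_node] at h
      obtain ⟨g, ss, i, t', hs, rfl, hi, rfl⟩ := h.exists_of_cons
      obtain rfl := node_root_inj hs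
      obtain rfl := node_inj hs
      rw [node_cons] at hv
      obtain ⟨t, h1, rfl⟩ := ih (ha.of_node i) hv hi
      refine ⟨t, h1, ?_⟩
      rw [subst_node]
      congr 1
      funext k
      by_cases hk : k = i
      · subst hk
        simp
      · rw [Function.update_of_ne hk]
        refine subst_congr fun y hy => ?_
        have : y ≠ x := by
          rintro rfl
          exact hk (ha.index_eq hy ⟨v, hv⟩)
        rw [Function.update_of_ne this]

/-- A step from a redex either overlaps with it, and then has the same result as its contraction,
or rewrites the substitution. -/
theorem WeaklyOrthogonal.step_redex [Infinite X] (hR : R.WeaklyOrthogonal) {ρ : IRule S X}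
    (hρ : ρ ∈ R.rules) {σ : X → ITerm S X} {s : ITerm S X} (h : R.Step (ρ.lhs.subst σ) s) :
    s = ρ.rhs.subst σ ∨
      ∃ τ : X → ITerm S X, s = ρ.lhs.subst τ ∧ ∀ x, ReflTransGen R.Step (σ x) (τ x) := by
  classical
  obtain ⟨q, hq⟩ := h
  rcases mem_pos_subst (show q ∈ (ρ.lhs.subst σ).Pos by
    obtain ⟨_, _, _, h, _⟩ := hq; exact h) with ⟨f, hf⟩ | ⟨v, q, x, rfl, hv, -⟩
  · left
    obtain ⟨ρ₂, hρ₂, τ, hpos, h1, rfl⟩ := hq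
    exact hR.overlap hρ hρ₂ hf h1
  · right
    obtain ⟨t, ht, rfl⟩ := hq.subst_of_var (hR.1 ρ hρ) hv
    refine ⟨_, rfl, fun y => ?_⟩
    by_cases hy : y = x
    · subst hy
      simpa using ReflTransGen.single ⟨q, ht⟩
    · rw [Function.update_of_ne hy]

/-- If no redex contracted in a parallel step overlaps with the pattern `a`, then the pattern
persists, and the subterms at its positions are again related by parallel steps. The hypothesis
`hno` expresses non-overlap: contracting first a redex at a position of the pattern does
not leave a parallel step with the same result. -/
theorem Par.subterm_of_no_overlap {a s t : ITerm S X} (h : R.Par s t)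
    (hm : ∀ p f, a.toFun p = some (Sum.inl f) → s.toFun p = some (Sum.inl f))
    (hno : ∀ p f, a.toFun p = some (Sum.inl f) → ∀ ρ ∈ R.rules, ∀ τ : X → ITerm S X,
      s.subterm p = ρ.lhs.subst τ → ¬ R.Par (s.replaceAt p (ρ.rhs.subst τ)) t)
    {p : List ℕ} (hp : p ∈ a.Pos) :
    p ∈ t.Pos ∧ R.Par (s.subterm p) (t.subterm p) ∧
      ∀ f, a.toFun p = some (Sum.inl f) → t.toFun p = some (Sum.inl f) := by
  have hlift : ∀ f, a.toFun [] = some (Sum.inl f) → Lift R.Par s t := by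
    intro f hf
    refine h.cases.resolve_left ?_
    rintro ⟨ρ, hρ, σ, h1, rfl⟩
    exact hno [] f hf ρ hρ σ (by simpa using h1) (by simpa using Par.refl _)
  induction p generalizing a s t with
  | nil =>
    refine ⟨t.nil_mem_pos, by simpa using h, fun f hf => ?_⟩
    have h1 := hm [] f hf
    obtain ⟨ss, rfl⟩ := eq_node_of_root h1
    obtain ⟨ts, rfl, -⟩ := (hlift f hf).of_node_left
    rfl
  | cons j p ih =>
    rcases a.var_or_node with ⟨y, rfl⟩ | ⟨f, as, rfl⟩
    · simp [Pos] at hp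
    · obtain ⟨i, rfl, hi⟩ := node_cons_isSome hp
      obtain ⟨ss, rfl⟩ := eq_node_of_root (hm [] f rfl)
      obtain ⟨ts, rfl, hts⟩ := (hlift f rfl).of_node_left
      have hm' : ∀ p g, (as i).toFun p = some (Sum.inl g) → (ss i).toFun p = some (Sum.inl g) :=
        fun p g hg => by simpa using hm ((i.val + 1) :: p) g (by simpa using hg)
      have hno' : ∀ p g, (as i).toFun p = some (Sum.inl g) → ∀ ρ ∈ R.rules,
          ∀ τ : X → ITerm S X, (ss i).subterm p = ρ.lhs.subst τ →
          ¬ R.Par ((ss i).replaceAt p (ρ.rhs.subst τ)) (ts i) := by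
        intro p g hg ρ hρ τ h1 h2
        have hps : p ∈ (ss i).Pos := by simp [Pos, hm' p g hg]
        refine hno ((i.val + 1) :: p) g (by simpa using hg) ρ hρ τ (by rw [subterm_node hps, h1]) ?_
        rw [replaceAt_node hps]
        refine Par.of_lift (Lift.node _ _ _ fun k => ?_)
        by_cases hk : k = i
        · subst hk
          simpa using h2
        · simpa [hk] using hts k
      have hlift' : ∀ g, (as i).toFun [] = some (Sum.inl g) → Lift R.Par (ss i) (ts i) := by
        intro g hg
        refine (hts i).cases.resolve_left ?_
        rintro ⟨ρ, hρ, σ, h1, h2⟩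
        exact hno' [] g hg ρ hρ σ (by simpa using h1) (by rw [h2]; simpa using Par.refl _)
      obtain ⟨hpt, h1, h2⟩ := ih (hts i) hm' hno' hi hlift'
      rw [subterm_node (matches_pos hm' hi), subterm_node hpt]
      exact ⟨cons_mem_pos_node.2 hpt, h1, fun g hg => by simpa using h2 g (by simpa using hg)⟩

/-- A parallel step from an instance of a linear term either contracts a redex that overlaps with
this term, which may then be contracted first, or acts on the substitution. -/
theorem Par.subst_cases {a t : ITerm S X} (ha : a.Linear) {σ : X → ITerm S X}
    (h : R.Par (a.subst σ) t) :
    (∃ p f, a.toFun p = some (Sum.inl f) ∧ ∃ ρ ∈ R.rules, ∃ τ : X → ITerm S X,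
      (a.subst σ).subterm p = ρ.lhs.subst τ ∧
        R.Par ((a.subst σ).replaceAt p (ρ.rhs.subst τ)) t) ∨
    ∃ τ : X → ITerm S X, t = a.subst τ ∧ ∀ x ∈ a.vars, R.Par (σ x) (τ x) := by
  refine or_iff_not_imp_left.2 fun hno => ?_
  have key : ∀ p ∈ a.Pos, p ∈ t.Pos ∧ R.Par ((a.subst σ).subterm p) (t.subterm p) ∧
      ∀ f, a.toFun p = some (Sum.inl f) → t.toFun p = some (Sum.inl f) := fun p hp =>
    h.subterm_of_no_overlap (fun p f hf => subst_toFun_symb σ hf)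
      (fun p f hf ρ hρ τ h1 h2 => hno ⟨p, f, hf, ρ, hρ, τ, h1, h2⟩) hp
  obtain ⟨τ, ht, hτ⟩ := ha.exists_eq_subst (t := t) fun p f hp =>
    (key p (by simp [Pos, hp])).2.2 f hp
  refine ⟨τ, ht, fun x ⟨p, hp⟩ => ?_⟩
  have h1 := (key p (by simp [Pos, hp])).2.1
  rwa [subterm_subst_var σ hp, ← hτ p x hp] at h1

/-- The parallel moves lemma for a single step. If the step overlaps with a contracted redex,
then weak orthogonality allows to replace it by the contraction of that redex. -/
theorem Par.exists_of_stepAt [Infinite X] (hR : R.WeaklyOrthogonal) {q : List ℕ}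
    {s s' t : ITerm S X} (h : R.Par s t) (hs : R.StepAt q s s') :
    ∃ u, R.Par s' u ∧ R.Red t u := by
  induction q generalizing s s' t with
  | nil =>
    obtain ⟨ρ, hρ, σ, rfl, rfl⟩ := stepAt_nil.1 hs
    rcases h.subst_cases (hR.1 ρ hρ) with ⟨p, f, hf, ρ₂, hρ₂, τ, h1, h2⟩ | ⟨τ, rfl, hτ⟩
    · rw [hR.overlap hρ hρ₂ hf h1] at h2
      exact ⟨t, h2, Red.refl t⟩
    · exact ⟨ρ.rhs.subst τ, Par.subst fun x hx => hτ x (ρ.vars_subset hx),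
        Red.of_steps (ReflTransGen.single ⟨[], stepAt_nil.2 ⟨ρ, hρ, τ, rfl, rfl⟩⟩)⟩
  | cons j q ih =>
    rcases h.cases with ⟨ρ, hρ, σ, rfl, rfl⟩ | h
    · rcases hR.step_redex hρ ⟨_, hs⟩ with rfl | ⟨τ, rfl, hτ⟩
      · exact ⟨_, Par.refl _, Red.refl _⟩
      · exact ⟨ρ.rhs.subst τ, Par.of_rootStep ⟨ρ, hρ, τ, rfl, rfl⟩,
          Red.subst fun x _ => Red.of_steps (hτ x)⟩
    · obtain ⟨f, ss, i, s'', rfl, rfl, hi, rfl⟩ := hs.exists_of_cons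
      obtain ⟨ts, rfl, hts⟩ := h.of_node_left
      obtain ⟨u, h1, h2⟩ := ih (hts i) hi
      refine ⟨node f (Function.update ts i u), Par.of_lift (Lift.node _ _ _ fun k => ?_),
        Red.of_lift_refl (Lift.node _ _ _ fun k => ?_)⟩
      · by_cases hk : k = i
        · subst hk
          simpa using h1
        · simpa [hk] using hts k
      · by_cases hk : k = i
        · subst hk
          simpa using h2
        · simpa [hk] using Red.refl (ts k)

theorem Par.exists_of_steps [Infinite X] (hR : R.WeaklyOrthogonal) {s s' t : ITerm S X}
    (h : R.Par s t) (hs : ReflTransGen R.Step s s') : ∃ u, R.Par s' u ∧ R.Red t u := by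
  induction hs with
  | refl => exact ⟨t, h, Red.refl t⟩
  | tail _ hs ih =>
    obtain ⟨q, hq⟩ := hs
    obtain ⟨u, h1, h2⟩ := ih
    obtain ⟨v, h3, h4⟩ := h1.exists_of_stepAt hR hq
    exact ⟨v, h3, h2.trans hR.1 h4⟩

/-! ### Parallel steps against infinitary reductions -/

theorem lift_red_of_stepGe {n : ℕ} {s t : ITerm S X} (h : R.StepGe (n + 1) s t) :
    Lift R.Red s t := by
  obtain ⟨p, hp, h⟩ := h
  obtain ⟨j, p, rfl⟩ : ∃ j q, p = j :: q := List.exists_cons_of_length_pos (by omega)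
  obtain ⟨f, ss, i, s', rfl, rfl, hi, rfl⟩ := h.exists_of_cons
  refine Lift.node _ _ _ fun k => ?_
  by_cases hk : k = i
  · subst hk
    simpa using Red.of_steps (ReflTransGen.single ⟨p, hi⟩)
  · simpa [hk] using Red.refl (ss k)

/-- A root step against an infinitary reduction without root steps. As long as no step overlaps
with the redex pattern, the reduction acts on the substitution; it continues the
contracted redex from the first overlapping step on, because this step could be replaced by the
root step. The right-hand sides not being variables, no step is moved up to the root. -/
theorem RootStep.exists_of_lift_red [Infinite X] (hR : R.WeaklyOrthogonal) (hnc : R.NonCollapsing)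
    {s t₁ t₂ : ITerm S X} (h : Lift R.Red s t₁) (hs : R.RootStep s t₂) :
    ∃ u, R.Par t₁ u ∧ Lift R.Red t₂ u := by
  obtain ⟨ρ, hρ, σ, rfl, rfl⟩ := hs
  obtain ⟨n, hn⟩ := ρ.lhs_finite.exists_length_lt
  have hn1 : 1 ≤ n := Nat.one_le_iff_ne_zero.2 (by
    have := hn [] ρ.lhs.nil_mem_pos
    simp at this
    omega)
  have htrans : ∀ a b c : ITerm S X, R.Red a b → R.Red b c → R.Red a c :=
    fun _ _ _ h1 h2 => h1.trans hR.1 h2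
  obtain ⟨s', h1, h2⟩ := exists_stepGe_lift_iterate hn1 (show Lift^[1] R.Red _ _ from h)
  -- First alternative: no overlap so far. Second alternative: an overlap has occurred.
  have key : (∃ τ : X → ITerm S X, s' = ρ.lhs.subst τ ∧
      Lift R.Red (ρ.rhs.subst σ) (ρ.rhs.subst τ)) ∨ Lift R.Red (ρ.rhs.subst σ) s' := by
    clear h2
    induction h1 with
    | refl => exact Or.inl ⟨σ, rfl, Lift.refl Red.refl _⟩
    | tail _ hstep ih =>
      rcases ih with ⟨τ, rfl, hτ⟩ | ih
      · obtain ⟨p, -, hp⟩ := hstep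
        rcases hR.step_redex hρ ⟨p, hp⟩ with rfl | ⟨τ', rfl, hτ'⟩
        · exact Or.inr hτ
        · exact Or.inl ⟨τ', rfl, hτ.trans htrans
            (Red.lift_subst (hnc ρ hρ) fun x _ => Red.of_steps (hτ' x))⟩
      · exact Or.inr (ih.trans htrans (lift_red_of_stepGe hstep))
  rcases key with ⟨τ, rfl, hτ⟩ | key
  · obtain ⟨τ', rfl, hτ'⟩ := lift_iterate_subst_left (hR.1 ρ hρ) hn Red.of_lift_iterate' h2
    exact ⟨ρ.rhs.subst τ', Par.of_rootStep ⟨ρ, hρ, τ', rfl, rfl⟩, hτ.trans htrans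
      (Red.lift_subst (hnc ρ hρ) fun x hx => hτ' x (ρ.vars_subset hx))⟩
  · obtain ⟨m, rfl⟩ : ∃ m, n = m + 1 := ⟨n - 1, by omega⟩
    rw [lift_iterate_succ] at h2
    exact ⟨t₁, Par.refl t₁, key.trans htrans (h2.mono (Red.of_lift_iterate' m))⟩

/-- The parallel moves lemma for infinitary reductions. The common reduct is generated root
symbol by root symbol: after finitely many steps the reduction leaves the root alone, and then
either the parallel step is a root step or the subterms are treated independently. -/
theorem Red.exists_of_par [Infinite X] (hR : R.WeaklyOrthogonal) (hnc : R.NonCollapsing)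
    {s t₁ t₂ : ITerm S X} (h : R.Red s t₁) (hs : R.Par s t₂) :
    ∃ u, R.Par t₁ u ∧ R.Red t₂ u := by
  -- The states are the pairs of terms whose common reduct is to be generated.
  let A := {x : ITerm S X × ITerm S X // ∃ s, R.Red s x.1 ∧ R.Par s x.2}
  obtain ⟨u, hu⟩ := exists_corec (A := A) (fun a u => R.Par a.1.1 u ∧ R.Red a.1.2 u)
    (fun a f n => a.1.1 = node f (fun i => (n i).1.1) ∧
      R.Red a.1.2 (node f (fun i => (n i).1.2))) (by
    rintro ⟨⟨t₁, t₂⟩, s, h, hs⟩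
    obtain ⟨s', h1, h2⟩ := h.exists_lift
    obtain ⟨v, h3, h4⟩ := hs.exists_of_steps hR h1
    rcases h3.cases with h3 | h3
    · obtain ⟨u, h5, h6⟩ := RootStep.exists_of_lift_red hR hnc h2 h3
      exact Or.inl ⟨u, h5, h4.trans hR.1 (Red.of_lift_refl h6)⟩
    · cases h2 with
      | var x =>
        obtain rfl := h3.of_var_left
        exact Or.inl ⟨_, Par.refl _, h4⟩
      | node f ss t₁s hh =>
        obtain ⟨vs, rfl, hvs⟩ := h3.of_node_left
        exact Or.inr ⟨f, fun i => ⟨(t₁s i, vs i), ss i, hh i, hvs i⟩, rfl, h4⟩)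
  let a₀ : A := ⟨(t₁, t₂), s, h, hs⟩
  refine ⟨u a₀, ?_, ?_⟩
  · refine Par.coinduct (fun x y => ∃ a : A, x = a.1.1 ∧ y = u a) ?_ ⟨a₀, rfl, rfl⟩
    rintro _ _ ⟨a, rfl, rfl⟩
    rcases hu a with ⟨h1, -⟩ | ⟨f, n, ⟨h1, -⟩, h3⟩
    · exact h1.cases.imp_right fun h => h.mono fun _ _ => Or.inr
    · rw [h1, h3]
      exact Or.inr (Lift.node _ _ _ fun i => Or.inl ⟨n i, rfl, rfl⟩)
  · refine Red.coinduct (fun x y => ∃ a : A, R.Red x a.1.2 ∧ y = u a) ?_ ⟨a₀, Red.refl _, rfl⟩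
    rintro x _ ⟨a, hx, rfl⟩
    rcases hu a with ⟨-, h1⟩ | ⟨f, n, ⟨-, h1⟩, h3⟩
    · obtain ⟨x', h2, h3⟩ := (hx.trans hR.1 h1).exists_lift
      exact ⟨x', h2, h3.mono fun _ _ => Or.inr⟩
    · obtain ⟨x', h4, h5⟩ := (hx.trans hR.1 h1).exists_lift
      obtain ⟨xs, rfl, hxs⟩ := h5.of_node_right
      refine ⟨_, h4, ?_⟩
      rw [h3]
      exact Lift.node _ _ _ fun i => Or.inl ⟨n i, hxs i, rfl⟩

/-- The parallel moves lemma does not create root steps. -/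
theorem Lift.exists_of_par [Infinite X] (hR : R.WeaklyOrthogonal) (hnc : R.NonCollapsing)
    {s t₁ t₂ : ITerm S X} (h : Lift R.Red s t₁) (hs : R.Par s t₂) :
    ∃ u, R.Par t₁ u ∧ Lift R.Red t₂ u := by
  rcases hs.cases with hs | hs
  · exact RootStep.exists_of_lift_red hR hnc h hs
  · cases h with
    | var x =>
      obtain rfl := hs.of_var_left
      exact ⟨_, Par.refl _, Lift.var x⟩
    | node f ss t₁s hh =>
      obtain ⟨vs, rfl, hvs⟩ := hs.of_node_left
      choose us h1 h2 using fun i => (hh i).exists_of_par hR hnc (hvs i)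
      exact ⟨node f us, Par.of_lift (Lift.node _ _ _ h1), Lift.node _ _ _ h2⟩

theorem Red.exists_of_steps [Infinite X] (hR : R.WeaklyOrthogonal) (hnc : R.NonCollapsing)
    {s t₁ t₂ : ITerm S X} (h : R.Red s t₁) (hs : ReflTransGen R.Step s t₂) :
    ∃ u, R.Red t₁ u ∧ R.Red t₂ u := by
  induction hs with
  | refl => exact ⟨t₁, Red.refl _, h⟩
  | tail _ hs ih =>
    obtain ⟨q, hq⟩ := hs
    obtain ⟨u, h1, h2⟩ := ih
    obtain ⟨v, h3, h4⟩ := h2.exists_of_par hR hnc (Par.of_stepAt hq)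
    exact ⟨v, h1.trans hR.1 h3.red, h4⟩

theorem Lift.exists_of_steps [Infinite X] (hR : R.WeaklyOrthogonal) (hnc : R.NonCollapsing)
    {s t₁ t₂ : ITerm S X} (h : Lift R.Red s t₁) (hs : ReflTransGen R.Step s t₂) :
    ∃ u, R.Red t₁ u ∧ Lift R.Red t₂ u := by
  induction hs with
  | refl => exact ⟨t₁, Red.refl _, h⟩
  | tail _ hs ih =>
    obtain ⟨q, hq⟩ := hs
    obtain ⟨u, h1, h2⟩ := ih
    obtain ⟨v, h3, h4⟩ := Lift.exists_of_par hR hnc h2 (Par.of_stepAt hq)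
    exact ⟨v, h1.trans hR.1 h3.red, h4⟩

/-! ### Confluence of the coinductive rewrite relation -/

/-- The common reduct is generated root symbol by root symbol. The finite initial part of one
reduction that affects the root is projected over the other reduction, and then the same is done
with the roles exchanged; the second projection does not create root steps, so that
both reductions then leave the root alone. -/
theorem Red.confluent [Infinite X] (hR : R.WeaklyOrthogonal) (hnc : R.NonCollapsing)
    {s t₁ t₂ : ITerm S X} (h₁ : R.Red s t₁) (h₂ : R.Red s t₂) :
    ∃ u, R.Red t₁ u ∧ R.Red t₂ u := by
  let A := {x : ITerm S X × ITerm S X // ∃ s, R.Red s x.1 ∧ R.Red s x.2}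
  obtain ⟨u, hu⟩ := exists_corec (A := A) (fun a u => R.Red a.1.1 u ∧ R.Red a.1.2 u)
    (fun a f n => R.Red a.1.1 (node f (fun i => (n i).1.1)) ∧
      R.Red a.1.2 (node f (fun i => (n i).1.2))) (by
    rintro ⟨⟨t₁, t₂⟩, s, h₁, h₂⟩
    obtain ⟨s₁, h3, h4⟩ := h₁.exists_lift
    obtain ⟨t₂', h5, h6⟩ := h₂.exists_of_steps hR hnc h3
    obtain ⟨s₂, h7, h8⟩ := h6.exists_lift
    obtain ⟨t₁', h9, h10⟩ := Lift.exists_of_steps hR hnc h4 h7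
    cases h8 with
    | var x =>
      obtain rfl := h10.of_var_left
      exact Or.inl ⟨_, h9, h5⟩
    | node f ss cs hh =>
      obtain ⟨bs, rfl, hbs⟩ := h10.of_node_left
      exact Or.inr ⟨f, fun i => ⟨(bs i, cs i), ss i, hbs i, hh i⟩, h9, h5⟩)
  have key : ∀ g : ITerm S X × ITerm S X → ITerm S X,
      (∀ a : A, R.Red (g a.1) (u a) ∨ ∃ f, ∃ n : Fin (S.arity f) → A,
        R.Red (g a.1) (node f fun i => g (n i).1) ∧ u a = node f fun i => u (n i)) →
      ∀ a : A, R.Red (g a.1) (u a) := by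
    intro g hg a
    refine Red.coinduct (fun x y => ∃ a : A, R.Red x (g a.1) ∧ y = u a) ?_ ⟨a, Red.refl _, rfl⟩
    rintro x _ ⟨a, hx, rfl⟩
    rcases hg a with h1 | ⟨f, n, h1, h3⟩
    · obtain ⟨x', h2, h3⟩ := (hx.trans hR.1 h1).exists_lift
      exact ⟨x', h2, h3.mono fun _ _ => Or.inr⟩
    · obtain ⟨x', h4, h5⟩ := (hx.trans hR.1 h1).exists_lift
      obtain ⟨xs, rfl, hxs⟩ := h5.of_node_right
      refine ⟨_, h4, ?_⟩
      rw [h3]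
      exact Lift.node _ _ _ fun i => Or.inl ⟨n i, hxs i, rfl⟩
  let a₀ : A := ⟨(t₁, t₂), s, h₁, h₂⟩
  exact ⟨u a₀,
    key Prod.fst (fun a => (hu a).imp (fun h => h.1) fun ⟨f, n, h1, h2⟩ => ⟨f, n, h1.1, h2⟩) a₀,
    key Prod.snd (fun a => (hu a).imp (fun h => h.2) fun ⟨f, n, h1, h2⟩ => ⟨f, n, h1.2, h2⟩) a₀⟩

end ITRS

namespace ITerm

variable {S : Signature.{u}} {X : Type v}

/-! ### The metric -/

theorem metric_nonneg (s t : ITerm S X) : 0 ≤ s.metric t := by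
  unfold metric
  split_ifs <;> positivity

theorem toFun_eq_of_metric_lt {n : ℕ} {s t : ITerm S X} (h : s.metric t < (2 : ℝ)⁻¹ ^ n)
    {p : List ℕ} (hp : p.length ≤ n) : s.toFun p = t.toFun p := by
  by_contra hne
  have hst : s ≠ t := fun h => hne (by rw [h])
  simp only [metric, hst, if_false] at h
  have h1 : sInf {k : ℕ | ∃ p : List ℕ, p.length = k ∧ s.toFun p ≠ t.toFun p} ≤ p.length :=
    Nat.sInf_le ⟨p, rfl, hne⟩
  exact absurd h (not_lt.2 (pow_le_pow_of_le_one (by norm_num) (by norm_num) (h1.trans hp)))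

theorem metric_le_of_toFun_eq {n : ℕ} {s t : ITerm S X}
    (h : ∀ p : List ℕ, p.length < n → s.toFun p = t.toFun p) : s.metric t ≤ (2 : ℝ)⁻¹ ^ n := by
  unfold metric
  split_ifs with hst
  · positivity
  · refine pow_le_pow_of_le_one (by norm_num) (by norm_num) (le_csInf ?_ ?_)
    · by_contra hne
      refine hst (ext_toFun fun p => ?_)
      by_contra hp
      exact hne ⟨_, p, rfl, hp⟩
    · rintro _ ⟨p, rfl, hp⟩
      by_contra hlt
      exact hp (h p (not_le.1 hlt))

end ITerm

namespace ITRS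

variable {S : Signature.{u}} {X : Type v} {R : ITRS S X}

open ITerm Relation

/-! ### From transfinite to coinductive rewriting -/

theorem StepAt.lift_iterate_red {n : ℕ} {p : List ℕ} {s t : ITerm S X} (hp : n ≤ p.length)
    (h : R.StepAt p s t) : Lift^[n] R.Red s t := by
  induction n generalizing p s t with
  | zero => exact Red.of_steps (ReflTransGen.single ⟨p, h⟩)
  | succ n ih =>
    obtain ⟨j, p, rfl⟩ : ∃ j q, p = j :: q := List.exists_cons_of_length_pos (by omega)
    obtain ⟨f, ss, i, s', rfl, rfl, hi, rfl⟩ := h.exists_of_cons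
    rw [lift_iterate_succ]
    refine Lift.node _ _ _ fun k => ?_
    by_cases hk : k = i
    · subst hk
      simpa using ih (by simpa using hp) hi
    · simpa [hk] using lift_iterate_refl Red.refl n (ss k)

/-- A sequence of infinitary reductions from `s` at increasing depths, starting with `n`, that
converges to `u`. -/
def RedChain (R : ITRS S X) (n : ℕ) (s u : ITerm S X) : Prop :=
  ∃ c : ℕ → ITerm S X, c 0 = s ∧ (∀ m, Lift^[n + m] R.Red (c m) (c (m + 1))) ∧
    ∀ m, ∀ p : List ℕ, p.length < n + m → (c (m + 1)).toFun p = u.toFun p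

/-- A chain at positive depth is a chain in each of the immediate subterms, since all
its terms have the root symbol of the limit. -/
theorem RedChain.lift {n : ℕ} {s u : ITerm S X} (h : R.RedChain (n + 1) s u) :
    Lift (R.RedChain n) s u := by
  obtain ⟨c, rfl, h1, h2⟩ := h
  have h1' : ∀ m, Lift (Lift^[n + m] R.Red) (c m) (c (m + 1)) := fun m => by
    rw [← lift_iterate_succ, show n + m + 1 = n + 1 + m by omega]
    exact h1 m
  have hroot : ∀ m, (c (m + 1)).toFun [] = u.toFun [] := fun m => h2 m [] (by simp)
  rcases u.var_or_node with ⟨x, rfl⟩ | ⟨f, us, rfl⟩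
  · have h3 := h1' 0
    rw [eq_var_of_root (hroot 0)] at h3
    rw [h3.of_var_right]
    exact Lift.var x
  · have hc : ∀ m, ∃ ts, c m = node f ts := by
      rintro (_ | m)
      · obtain ⟨ts, hts⟩ := eq_node_of_root (hroot 0)
        have h3 := h1' 0
        rw [hts] at h3
        obtain ⟨ss, hss, -⟩ := h3.of_node_right
        exact ⟨ss, hss⟩
      · exact eq_node_of_root (hroot m)
    choose cs hcs using hc
    rw [hcs 0]
    refine Lift.node _ _ _ fun i => ⟨fun m => cs m i, rfl, fun m => ?_, fun m p hp => ?_⟩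
    · have h3 := h1' m
      rw [hcs m, hcs (m + 1)] at h3
      obtain ⟨ts, hts, h4⟩ := h3.of_node_left
      rw [← node_inj hts] at h4
      exact h4 i
    · have h3 := h2 m ((i.val + 1) :: p) (by simp; omega)
      rw [hcs (m + 1)] at h3
      simpa using h3

theorem RedChain.red (hR : R.LeftLinear) {s u : ITerm S X} (h : R.RedChain 0 s u) :
    R.Red s u := by
  refine Red.coinduct (R.RedChain 0) ?_ h
  rintro s u ⟨c, rfl, h1, h2⟩
  have h3 : R.Red (c 0) (c 1) := h1 0
  obtain ⟨s', h4, h5⟩ := h3.exists_lift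
  have h6 : R.RedChain 1 s' u := by
    refine ⟨fun m => Nat.casesOn m s' fun m => c (m + 2), rfl, fun m => ?_, fun m p hp => ?_⟩
    · rcases m with _ | m
      · exact h5.trans (fun _ _ _ h h' => h.trans hR h') (h1 1)
      · have := h1 (m + 2)
        rw [show 1 + (m + 1) = 0 + (m + 2) by omega]
        exact this
    · exact h2 (m + 1) p (by omega)
  exact ⟨s', h4, h6.lift.mono fun _ _ => Or.inl⟩

theorem RedChain.lift_iterate_red (hR : R.LeftLinear) {n : ℕ} {s u : ITerm S X}
    (h : R.RedChain n s u) : Lift^[n] R.Red s u := by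
  induction n generalizing s u with
  | zero => exact h.red hR
  | succ n ih =>
    rw [lift_iterate_succ]
    exact h.lift.mono fun _ _ => ih

theorem exists_lt_forall_of_eventually_nhdsLT {l : Ordinal.{0}} (hl : Order.IsSuccLimit l)
    {P : Ordinal.{0} → Prop} (h : ∀ᶠ β in 𝓝[<] l, P β) : ∃ b < l, ∀ δ, b ≤ δ → δ < l → P δ := by
  have h0 : (0 : Ordinal.{0}) < l := by
    rw [pos_iff_ne_zero]
    rintro rfl
    exact hl.not_isMin isMin_bot
  obtain ⟨b, hb, hs⟩ := (mem_nhdsLT_iff_exists_Ioo_subset' h0).1 h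
  exact ⟨Order.succ b, hl.succ_lt hb, fun δ h1 h2 => hs ⟨Order.succ_le_iff.1 h1, h2⟩⟩

/-- Compression of transfinite rewrite sequences: the part between `β` and `γ` of a strongly
convergent sequence with steps at depth at least `n` is an infinitary reduction at this depth. -/
theorem lift_iterate_red_of_seq (hR : R.LeftLinear) {α : Ordinal.{0}}
    {t : Ordinal.{0} → ITerm S X} {p : Ordinal.{0} → List ℕ}
    (hstep : ∀ β < α, R.StepAt (p β) (t β) (t (β + 1)))
    (hdist : ∀ l ≤ α, Order.IsSuccLimit l →
      Tendsto (fun β => (t β).metric (t l)) (𝓝[<] l) (𝓝 0))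
    (hdepth : ∀ l ≤ α, Order.IsSuccLimit l →
      Tendsto (fun β => (p β).length) (𝓝[<] l) atTop)
    (γ : Ordinal.{0}) (hγ : γ ≤ α) (β : Ordinal.{0}) (hβ : β ≤ γ) (n : ℕ)
    (hn : ∀ δ, β ≤ δ → δ < γ → n ≤ (p δ).length) : Lift^[n] R.Red (t β) (t γ) := by
  have htrans : ∀ a b c : ITerm S X, R.Red a b → R.Red b c → R.Red a c :=
    fun _ _ _ h1 h2 => h1.trans hR h2
  induction γ using Ordinal.limitRecOn generalizing β n with
  | zero =>
    obtain rfl : β = 0 := le_antisymm hβ zero_le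
    exact lift_iterate_refl Red.refl n _
  | add_one γ ih =>
    rcases hβ.eq_or_lt with rfl | hlt
    · exact lift_iterate_refl Red.refl n _
    · have hβγ : β ≤ γ := Order.lt_add_one_iff.1 hlt
      have hγα : γ < α := lt_of_lt_of_le (lt_add_one γ) hγ
      exact lift_iterate_trans htrans n
        (ih hγα.le β hβγ n fun δ h1 h2 => hn δ h1 (h2.trans (lt_add_one γ)))
        ((hstep γ hγα).lift_iterate_red (hn γ hβγ (lt_add_one γ)))
  | limit γ hl ih =>
    rcases hβ.eq_or_lt with rfl | hlt
    · exact lift_iterate_refl Red.refl n _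
    · have hex : ∀ m : ℕ, ∃ b < γ, ∀ δ, b ≤ δ → δ < γ →
          m ≤ (p δ).length ∧ (t δ).metric (t γ) < (2 : ℝ)⁻¹ ^ m := fun m =>
        exists_lt_forall_of_eventually_nhdsLT hl
          (((hdepth γ hγ hl).eventually_ge_atTop m).and
            ((hdist γ hγ hl).eventually_lt_const (by positivity)))
      choose b hb hb' using hex
      -- Start at `β` itself, where the steps have depth at least `n`, and then pass through
      -- ordinals that are large enough for depth `n + 1`, `n + 2`, and so on.
      let c : ℕ → Ordinal.{0} := fun m => Nat.rec β (fun m x => max x (b (n + m + 1))) m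
      have hcs : ∀ m, c (m + 1) = max (c m) (b (n + m + 1)) := fun m => rfl
      have hclt : ∀ m, c m < γ := by
        intro m
        induction m with
        | zero => exact hlt
        | succ m ihm => rw [hcs]; exact max_lt ihm (hb _)
      refine RedChain.lift_iterate_red hR ⟨fun m => t (c m), rfl, fun m => ?_, fun m q hq => ?_⟩
      · refine ih _ (hclt (m + 1)) ((hclt (m + 1)).le.trans hγ) _
          (by rw [hcs]; exact le_max_left _ _) _ fun δ h1 h2 => ?_
        rcases m with _ | m
        · exact hn δ h1 (h2.trans (hclt 1))
        · have h3 : b (n + m + 1) ≤ δ := (le_max_right _ _).trans h1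
          exact (hb' _ δ h3 (h2.trans (hclt (m + 1 + 1)))).1
      · exact toFun_eq_of_metric_lt (n := n + m + 1)
          (hb' _ (c (m + 1)) (by rw [hcs]; exact le_max_right _ _) (hclt (m + 1))).2 (by omega)

theorem InfRed.red (hR : R.LeftLinear) {s u : ITerm S X} (h : R.InfRed s u) : R.Red s u := by
  classical
  obtain ⟨α, t, p, hseq, hconv, rfl, hlim, hlim'⟩ := h
  by_cases hα : Order.IsSuccLimit α
  · have h0 : (0 : Ordinal.{0}) ≠ α := by
      rintro rfl
      exact hα.not_isMin isMin_bot
    -- At a limit length the value `t α` is arbitrary and has to be replaced by the final term.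
    have key := lift_iterate_red_of_seq (α := α) (t := Function.update t α u) (p := p) hR ?_ ?_ ?_
      α le_rfl 0 zero_le 0 fun _ _ _ => Nat.zero_le _
    · simpa [Function.update_of_ne h0] using key
    · intro β hβ
      have h1 : β + 1 < α := hα.succ_lt hβ
      rw [Function.update_of_ne hβ.ne, Function.update_of_ne h1.ne]
      exact hseq.step β hβ
    · intro l hl hl'
      have e : ∀ᶠ β in 𝓝[<] l, Function.update t α u β = t β := by
        filter_upwards [self_mem_nhdsWithin] with β hβ
        exact Function.update_of_ne (lt_of_lt_of_le hβ hl).ne _ _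
      rcases hl.eq_or_lt with rfl | hlt
      · refine (hlim' hα).congr' ?_
        filter_upwards [e] with β hβ
        rw [hβ, Function.update_self]
      · refine (hseq.dist_tendsto l hlt hl').congr' ?_
        filter_upwards [e] with β hβ
        rw [hβ, Function.update_of_ne hlt.ne]
    · intro l hl hl'
      rcases hl.eq_or_lt with rfl | hlt
      · exact hconv hα
      · exact hseq.depth_tendsto l hlt hl'
  · rw [hlim hα]
    have hlt : ∀ l ≤ α, Order.IsSuccLimit l → l < α := fun l hl hl' =>
      lt_of_le_of_ne hl (by rintro rfl; exact hα hl')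
    exact lift_iterate_red_of_seq hR hseq.step
      (fun l hl hl' => hseq.dist_tendsto l (hlt l hl hl') hl')
      (fun l hl hl' => hseq.depth_tendsto l (hlt l hl hl') hl')
      α le_rfl 0 zero_le 0 fun _ _ _ => Nat.zero_le _

/-! ### From coinductive to transfinite rewriting -/

/-- Sequences indexed by natural numbers are turned into sequences indexed by ordinals through
the map `β ↦ Cardinal.toNat β.card`, which inverts the embedding of `ℕ` into the ordinals. -/
theorem tendsto_toNat_card_nhdsLT_omega0 :
    Tendsto (fun β : Ordinal.{0} => Cardinal.toNat β.card) (𝓝[<] Ordinal.omega0) atTop := by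
  refine tendsto_atTop.2 fun n => ?_
  filter_upwards [Ioo_mem_nhdsLT (Ordinal.natCast_lt_omega0 n)] with β hβ
  obtain ⟨m, rfl⟩ := Ordinal.lt_omega0.1 hβ.2
  have : n < m := by simpa using hβ.1
  simpa using this.le

theorem isRewriteSeq_of_nat {α : Ordinal.{0}} (hα : α ≤ Ordinal.omega0) {c : ℕ → ITerm S X}
    {q : ℕ → List ℕ} (h : ∀ i : ℕ, (i : Ordinal.{0}) < α → R.StepAt (q i) (c i) (c (i + 1))) :
    R.IsRewriteSeq α (fun β => c (Cardinal.toNat β.card)) (fun β => q (Cardinal.toNat β.card)) := by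
  have hno : ∀ l < α, ¬ Order.IsSuccLimit l := fun l hl hl' =>
    absurd (Ordinal.omega0_le_of_isSuccLimit hl') (not_le.2 (hl.trans_le hα))
  refine ⟨fun β hβ => ?_, fun l hl hl' => absurd hl' (hno l hl),
    fun l hl hl' => absurd hl' (hno l hl)⟩
  obtain ⟨i, rfl⟩ := Ordinal.lt_omega0.1 (hβ.trans_le hα)
  have := h i hβ
  rw [← Nat.cast_succ]
  simpa using this

theorem InfRed.of_steps {s t : ITerm S X} (h : ReflTransGen R.Step s t) : R.InfRed s t := by
  have key : ∃ (m : ℕ) (c : ℕ → ITerm S X) (q : ℕ → List ℕ), c 0 = s ∧ c m = t ∧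
      ∀ i < m, R.StepAt (q i) (c i) (c (i + 1)) := by
    induction h using ReflTransGen.head_induction_on with
    | refl => exact ⟨0, fun _ => t, fun _ => [], rfl, rfl, fun i hi => absurd hi (by omega)⟩
    | @head a b hs _ ih =>
      obtain ⟨m, c, q, rfl, h2, h3⟩ := ih
      obtain ⟨p, hp⟩ := hs
      refine ⟨m + 1, fun i => Nat.casesOn i a c, fun i => Nat.casesOn i p q, rfl, h2,
        fun i hi => ?_⟩
      rcases i with _ | i
      · exact hp
      · exact h3 i (by omega)
  obtain ⟨m, c, q, h1, h2, h3⟩ := key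
  have hm : ¬ Order.IsSuccLimit (m : Ordinal.{0}) := fun hl =>
    absurd (Ordinal.omega0_le_of_isSuccLimit hl) (not_le.2 (Ordinal.natCast_lt_omega0 m))
  exact ⟨m, _, _, isRewriteSeq_of_nat (Ordinal.natCast_lt_omega0 m).le
    fun i hi => h3 i (by exact_mod_cast hi), fun hl => absurd hl hm, by simpa using h1,
    fun _ => by simpa using h2.symm, fun hl => absurd hl hm⟩

theorem InfRed.of_omega {c : ℕ → ITerm S X} {q : ℕ → List ℕ} {t : ITerm S X}
    (h : ∀ i, R.StepAt (q i) (c i) (c (i + 1)))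
    (hq : Tendsto (fun i => (q i).length) atTop atTop)
    (hc : Tendsto (fun i => (c i).metric t) atTop (𝓝 0)) : R.InfRed (c 0) t := by
  have hl : Order.IsSuccLimit Ordinal.omega0.{0} := Ordinal.isSuccLimit_omega0
  exact ⟨Ordinal.omega0, _, _, isRewriteSeq_of_nat le_rfl fun i _ => h i,
    fun _ => hq.comp tendsto_toNat_card_nhdsLT_omega0, by simp, fun hn => absurd hl hn,
    fun _ => hc.comp tendsto_toNat_card_nhdsLT_omega0⟩

/-- `s` reaches, by `k` steps at depth at least `n`, a term from which `t` is
reached by an infinitary reduction at depth at least `n + 1`. -/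
def Pending (R : ITRS S X) (t : ITerm S X) (n : ℕ) : ℕ → ITerm S X → Prop
  | 0, s => Lift^[n + 1] R.Red s t
  | k + 1, s => ∃ s', R.StepGe n s s' ∧ Pending R t n k s'

theorem exists_pending {t : ITerm S X} {n : ℕ} {s s' : ITerm S X}
    (h : ReflTransGen (R.StepGe n) s s') (h' : Lift^[n + 1] R.Red s' t) :
    ∃ k, R.Pending t n k s := by
  induction h using ReflTransGen.head_induction_on with
  | refl => exact ⟨0, h'⟩
  | head hs _ ih =>
    obtain ⟨k, hk⟩ := ih
    exact ⟨k + 1, _, hs, hk⟩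

theorem Pending.lift_iterate_red (hR : R.LeftLinear) {t : ITerm S X} {n k : ℕ} {s : ITerm S X}
    (h : R.Pending t n k s) : Lift^[n] R.Red s t := by
  induction k generalizing s with
  | zero =>
    have h1 : Lift^[n + 1] R.Red s t := h
    rw [Function.iterate_succ_apply] at h1
    exact lift_iterate_mono (fun _ _ => Red.of_lift_refl) n h1
  | succ k ih =>
    obtain ⟨s', ⟨p, hp, hs⟩, h2⟩ := h
    exact lift_iterate_trans (fun _ _ _ h1 h2 => h1.trans hR h2) n (hs.lift_iterate_red hp) (ih h2)

/-- An infinitary reduction between different terms has a first step, and the remaining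
steps of the same minimal depth are finite in number. -/
theorem exists_stepGe_pending {t : ITerm S X} {n : ℕ} {s : ITerm S X}
    (h : Lift^[n] R.Red s t) (hne : s ≠ t) :
    ∃ m k s', n ≤ m ∧ R.StepGe m s s' ∧ R.Pending t m k s' := by
  by_contra! hno
  have key : ∀ m, n ≤ m → Lift^[m] R.Red s t := by
    intro m hm
    induction m, hm using Nat.le_induction with
    | base => exact h
    | succ m hm ih =>
      obtain ⟨s', h1, h2⟩ := exists_stepGe_of_lift_iterate ih
      rcases h1.cases_head with rfl | ⟨s₁, h3, h4⟩
      · exact h2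
      · obtain ⟨k, hk⟩ := exists_pending h4 h2
        exact absurd hk (hno m k s₁ hm h3)
  exact hne (ext_toFun fun p => lift_iterate_toFun (key (n + p.length + 1) (by omega)) (by omega))

/-- Every coinductive reduction is realized by a rewrite sequence of length at most `ω`. Each of
its steps either increases the minimal depth of the steps to come or decreases the finite number
of steps to come at that depth. -/
theorem Red.infRed (hR : R.LeftLinear) {s t : ITerm S X} (h : R.Red s t) : R.InfRed s t := by
  by_cases hfin : ReflTransGen R.Step s t
  · exact InfRed.of_steps hfin
  -- A state consists of the current depth, the number of pending steps at this depth, and a term.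
  let A := {x : ℕ × ℕ × ITerm S X // R.Pending t x.1 x.2.1 x.2.2 ∧ ReflTransGen R.Step s x.2.2}
  have hnext : ∀ x : A, ∃ y : A, R.StepGe x.1.1 x.1.2.2 y.1.2.2 ∧
      (x.1.1 < y.1.1 ∨ (x.1.1 = y.1.1 ∧ y.1.2.1 < x.1.2.1)) := by
    rintro ⟨⟨n, k, a⟩, h1, h2⟩
    rcases k with _ | k
    · have hne : a ≠ t := by
        rintro rfl
        exact hfin h2
      obtain ⟨m, k, a', h3, ⟨p, hp, h4⟩, h5⟩ := exists_stepGe_pending h1 hne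
      exact ⟨⟨⟨m, k, a'⟩, h5, h2.tail ⟨p, h4⟩⟩, ⟨p, by simp only; omega, h4⟩, Or.inl h3⟩
    · obtain ⟨a', ⟨p, hp, h4⟩, h5⟩ := h1
      exact ⟨⟨⟨n, k, a'⟩, h5, h2.tail ⟨p, h4⟩⟩, ⟨p, hp, h4⟩, Or.inr ⟨rfl, Nat.lt_succ_self k⟩⟩
  choose next hstep hdec using hnext
  obtain ⟨s', h1, h2⟩ := exists_stepGe_of_lift_iterate (n := 0) h
  obtain ⟨k, hk⟩ := exists_pending h1 h2
  let x : ℕ → A := fun i => next^[i] ⟨⟨0, k, s⟩, hk, ReflTransGen.refl⟩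
  have hx : ∀ i, x (i + 1) = next (x i) := fun i => Function.iterate_succ_apply' _ _ _
  have hmono : Monotone fun i => (x i).1.1 := monotone_nat_of_le_succ fun i => by
    rw [hx]
    rcases hdec (x i) with h | h
    · exact h.le
    · exact h.1.le
  have hgrow : ∀ k i, (x i).1.2.1 = k → ∃ j, (x i).1.1 < (x j).1.1 := by
    intro k
    induction k using Nat.strong_induction_on with
    | _ k ih =>
      rintro i rfl
      rcases hdec (x i) with h | ⟨h, h'⟩
      · exact ⟨i + 1, by rw [hx]; exact h⟩
      · rw [← hx] at h h'
        obtain ⟨j, hj⟩ := ih _ h' (i + 1) rfl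
        exact ⟨j, by rw [h]; exact hj⟩
  have hunb : Tendsto (fun i => (x i).1.1) atTop atTop := by
    refine tendsto_atTop_atTop_of_monotone hmono fun n => ?_
    induction n with
    | zero => exact ⟨0, Nat.zero_le _⟩
    | succ n ih =>
      obtain ⟨i, hi⟩ := ih
      obtain ⟨j, hj⟩ := hgrow _ i rfl
      exact ⟨j, by omega⟩
  choose q hq hqs using fun i => hstep (x i)
  refine InfRed.of_omega (c := fun i => (x i).1.2.2) (q := q) (fun i => ?_)
    (tendsto_atTop_mono hq hunb) ?_
  · rw [hx]
    exact hqs i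
  · refine squeeze_zero (fun _ => metric_nonneg _ _) (fun i => metric_le_of_toFun_eq fun p hp =>
      lift_iterate_toFun ((x i).2.1.lift_iterate_red hR) hp) ?_
    exact (tendsto_pow_atTop_nhds_zero_of_lt_one (by norm_num) (by norm_num)).comp hunb

theorem infRed_iff_red (hR : R.LeftLinear) {s t : ITerm S X} : R.InfRed s t ↔ R.Red s t :=
  ⟨InfRed.red hR, Red.infRed hR⟩

/-! ### Confluence, the Church–Rosser property and unique normal forms -/

theorem InfConfluent.infChurchRosser (hR : R.LeftLinear) (h : R.InfConfluent) :
    R.InfChurchRosser := by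
  intro t₁ t₂ hc
  induction hc with
  | refl => exact ⟨t₁, (Red.refl _).infRed hR, (Red.refl _).infRed hR⟩
  | tail _ hbc ih =>
    obtain ⟨s, h1, h2⟩ := ih
    rcases hbc with hbc | hbc
    · exact ⟨s, h1, ((hbc.red hR).trans hR (h2.red hR)).infRed hR⟩
    · obtain ⟨u, h3, h4⟩ := h _ _ _ h2 hbc
      exact ⟨u, ((h1.red hR).trans hR (h3.red hR)).infRed hR, h4⟩

theorem IsNormalForm.eq_of_infRed {s t : ITerm S X} (h : R.IsNormalForm s) (hst : R.InfRed s t) :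
    t = s := by
  obtain ⟨α, c, p, hseq, -, rfl, hlim, -⟩ := hst
  rcases eq_or_ne α 0 with rfl | hα
  · exact hlim fun hl => hl.not_isMin isMin_bot
  · exact absurd ⟨_, p 0, hseq.step 0 (pos_iff_ne_zero.2 hα)⟩ h

theorem InfChurchRosser.infUniqueNormalization (h : R.InfChurchRosser) :
    R.InfUniqueNormalization := by
  intro t₁ t₂ hc h₁ h₂
  obtain ⟨s, h3, h4⟩ := h t₁ t₂ hc
  rw [← h₁.eq_of_infRed h3, h₂.eq_of_infRed h4]

theorem WeaklyOrthogonal.infConfluent [Infinite X] (hR : R.WeaklyOrthogonal)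
    (hnc : R.NonCollapsing) : R.InfConfluent := by
  intro t t₁ t₂ h₁ h₂
  simp only [infRed_iff_red hR.1] at h₁ h₂ ⊢
  exact h₁.confluent hR hnc h₂

end ITRS

end InfRew

theorem mainTheorem1 {S : InfRew.Signature} {X : Type*} [Countable X] [Infinite X]
    (R : InfRew.ITRS S X) (hR : R.WeaklyOrthogonal) (hnc : R.NonCollapsing) :
    R.InfConfluent ∧ R.InfChurchRosser ∧ R.InfUniqueNormalization := by
  have hconf := hR.infConfluent hnc
  have hcr := hconf.infChurchRosser hR.1
  exact ⟨hconf, hcr, hcr.infUniqueNormalization⟩
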